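/- Let $b\neq 0$, $27s-38b^2>0$, $\varepsilon>0$, $\omega\in(-\tfrac12,\tfrac12)$ with $1+2\varepsilon\omega>0$, and let $\tilde u=\tilde u(x)$ be a roll, i.e. a real, even, $2\pi$-periodic stationary solution of $$\partial_t u=-(1+(1+2\varepsilon\omega)\partial_x^2+\partial_y^2)^2u+\varepsilon^2u+bu^2-su^3 .$$ Let $$\mathcal L=-(1+(1+2\varepsilon\omega)\partial_x^2+\partial_y^2)^2+\varepsilon^2+2b\tilde u-3s\tilde u^2$$ be the linearization about $\tilde u$ on $L^2(\mathbb R^2)$ with domain $H^4(\mathbb R^2)$, and for $\sigma=(\sigma_1,\sigma_2)\in\mathbb R^2$ let $$B(\sigma)=-\big[1+(1+2\varepsilon\omega)(\partial_x+i\sigma_1)^2-\sigma_2^2\big]^2+\varepsilon^2+2b\tilde u-3s\tilde u^2$$ be the Bloch operators on $L^2(\mathbb T)$, $\mathbb T=\mathbb R/2\pi\mathbb Z$, with domain $H^4(\mathbb T)$. Let $\bar\sigma\in\mathbb R^2$, $0<c_0\le 1$ and $I\times J=[\bar\sigma_1,\bar\sigma_1+c_0]\times[\bar\sigma_2,\bar\sigma_2+c_0]$.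 Suppose that for every $\sigma\in I\times J$ the number $\lambda(\sigma)>0$ is an (unstable) eigenvalue of $B(\sigma)$ with eigenfunction $W(\cdot,\sigma)\neq 0$, that $\sigma\mapsto W(\cdot,\sigma)\in H^2(\mathbb T)$ is continuous on $I\times J$, and that $\lambda_M:=\lambda(\bar\sigma)$ is the largest growth rate: no $B(\sigma)$, $\sigma\in\mathbb R^2$, has an eigenvalue larger than $\lambda_M$. Put $$U(x,y)=\int_{I\times J}e^{i(\sigma_1x+\sigma_2y)}W(x,\sigma)\,d\sigma,\qquad e(t)=\Big(\int_{I\times J}e^{2(\lambda(\sigma)-\lambda_M)t}\,d\sigma\Big)^{1/2}.$$ Then $U\in L^2(\mathbb R^2)$; the linearized equation $V_t=\mathcal LV$, $V(0)=U$ has exactly one solution $V=e^{t\mathcal L}U$ on $[0,\infty)$ (continuous on $[0,\infty)$ with values in $L^2(\mathbb R^2)$ and, for $t>0$, differentiable in $L^2(\mathbb R^2)$ with values in $H^4(\mathbb R^2)$); $e^{t\mathcal L}U\in H^2(\mathbb R^2)$ for all $t\ge 0$; and there is a constant $C\ge1$ with $$C^{-1}e^{\lambda_Mt}e(t)\le\|e^{t\mathcal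 L}U\|_{H^2(\mathbb R^2)}\le C\,e^{\lambda_Mt}e(t)\qquad\text{for all }t\ge0 .$$ Moreover there are positive constants $l$, $C_1$, $C_2$ with $$\frac{C_1}{(1+t)^{1/l}}\le e(t)\le C_2\qquad\text{for all }t\ge0 ,$$ and the lower bound holds (with some $C_1>0$ depending on $l$) for every integer $l\ge1$ such that $\lambda(\sigma)-\lambda_M=O(|\sigma-\bar\sigma|^l)$ as $\sigma\to\bar\sigma$ in $I\times J$; in particular, if $\lambda$ is analytic near $\bar\sigma$ and not constant, for the order $l$ of the first non-vanishing term in its Taylor expansion at $\bar\sigma$ after the constant one. -/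

import Mathlib

open MeasureTheory TemperedDistribution FourierTransform Filter Topology
open scoped LineDeriv SchwartzMap ENNReal

noncomputable section

namespace RollInstability

/-- The plane `ℝ²` of the variables `(x, y) = (p 0, p 1)`. -/
abbrev Plane : Type := EuclideanSpace ℝ (Fin 2)

/-- Complex `L²(ℝ²)`. -/
abbrev L2Plane : Type := Lp ℂ 2 (volume : Measure Plane)

/-- `(1 + (1 + 2εω)∂ₓ²) f`. -/
def rollOp (ε ω : ℝ) (f : ℝ → ℝ) (x : ℝ) : ℝ :=
  f x + (1 + 2 * ε * ω) * deriv (deriv f) x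

/-- `u` is a roll profile of the generalized Swift–Hohenberg equation
`∂ₜu = -(1 + (1 + 2εω)∂ₓ² + ∂_y²)²u + ε²u + bu² - su³`: an even, `2π`-periodic stationary
solution that depends on `x` only. -/
def IsRoll (ε ω b s : ℝ) (u : ℝ → ℝ) : Prop :=
  ContDiff ℝ 4 u ∧ Function.Periodic u (2 * Real.pi) ∧ Function.Even u ∧
    ∀ x, -(rollOp ε ω (rollOp ε ω u) x) + ε ^ 2 * u x + b * u x ^ 2 - s * u x ^ 3 = 0

/-- The zeroth-order coefficient `ε² + 2bu - 3su²` of the linearization about `u`. -/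
def potential (ε b s : ℝ) (u : ℝ → ℝ) (x : ℝ) : ℝ :=
  ε ^ 2 + 2 * b * u x - 3 * s * u x ^ 2

/-! ### The linearized operator on `L²(ℝ²)` -/

/-- `1 + (1 + 2εω)∂ₓ² + ∂_y²` on tempered distributions. -/
def planeOp (ε ω : ℝ) (v : 𝓢'(Plane, ℂ)) : 𝓢'(Plane, ℂ) :=
  v + ((1 + 2 * ε * ω : ℝ) : ℂ) •
      ∂_{(EuclideanSpace.single 0 1 : Plane)} (∂_{(EuclideanSpace.single 0 1 : Plane)} v) +
    ∂_{(EuclideanSpace.single 1 1 : Plane)} (∂_{(EuclideanSpace.single 1 1 : Plane)} v)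

/-- The graph of the operator `𝓛 = -(1 + (1 + 2εω)∂ₓ² + ∂_y²)² + ε² + 2bu - 3su²` on `L²(ℝ²)` with
domain `H⁴(ℝ²)`: `v ∈ H⁴(ℝ²)` and `𝓛 v = f`. Here `g` is the product of `v` with the potential. -/
def LinearizedOp (ε ω b s : ℝ) (u : ℝ → ℝ) (v f : L2Plane) : Prop :=
  MemSobolev 4 2 (v : 𝓢'(Plane, ℂ)) ∧
    ∃ g : L2Plane, (∀ᵐ p : Plane, g p = (potential ε b s u (p 0) : ℂ) * v p) ∧
      (f : 𝓢'(Plane, ℂ)) = -planeOp ε ω (planeOp ε ω (v : 𝓢'(Plane, ℂ))) + (g : 𝓢'(Plane, ℂ))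

/-- `V` is the orbit `t ↦ e^{t𝓛} w`, `t ≥ 0`, where `𝓛` is given by its graph: `V` is continuous on
`[0, ∞)` with values in `L²(ℝ²)`, `V 0 = w`, and for `t > 0` the value `V t` lies in the domain of
`𝓛` and `V' t = 𝓛 (V t)`. -/
def IsSemigroupOrbit (L : L2Plane → L2Plane → Prop) (w : L2Plane) (V : ℝ → L2Plane) : Prop :=
  V 0 = w ∧ ContinuousOn V (Set.Ici 0) ∧ ∀ t, 0 < t → ∃ f, L (V t) f ∧ HasDerivAt V f t

/-- The norm `‖v‖_{H^p(ℝ²)} = (∫ (1 + |ξ|²)^p |v̂(ξ)|² dξ)^{1/2}`. Mathlib's Fourier transform uses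
the kernel `e^{-2πi⟨ξ, ·⟩}`, hence the factor `2π`. -/
def sobolevNorm (p : ℕ) (v : L2Plane) : ℝ :=
  (eLpNorm (fun ξ : Plane =>
    (((1 + (2 * Real.pi * ‖ξ‖) ^ 2) ^ ((p : ℝ) / 2) : ℝ) : ℂ) * (𝓕 v : L2Plane) ξ) 2 volume).toReal

/-! ### Bloch operators on `L²(𝕋)`, `𝕋 = ℝ / 2πℤ` -/

/-- `(∂ₓ + iσ₁) f`. -/
def blochDeriv (σ : ℝ × ℝ) (f : ℝ → ℂ) (x : ℝ) : ℂ :=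
  deriv f x + Complex.I * σ.1 * f x

/-- `(1 + (1 + 2εω)(∂ₓ + iσ₁)² - σ₂²) f`. -/
def blochInner (ε ω : ℝ) (σ : ℝ × ℝ) (f : ℝ → ℂ) (x : ℝ) : ℂ :=
  f x + ((1 + 2 * ε * ω : ℝ) : ℂ) * blochDeriv σ (blochDeriv σ f) x - (σ.2 : ℂ) ^ 2 * f x

/-- The Bloch operator
`B(σ) = -(1 + (1 + 2εω)(∂ₓ + iσ₁)² - σ₂²)² + ε² + 2bu - 3su²` applied to `w`. -/
def blochOp (ε ω b s : ℝ) (u : ℝ → ℝ) (σ : ℝ × ℝ) (w : ℝ → ℂ) (x : ℝ) : ℂ :=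
  -(blochInner ε ω σ (blochInner ε ω σ w) x) + (potential ε b s u x : ℂ) * w x

/-- `w` is an eigenfunction of `B(σ)` for the eigenvalue `μ`. As the coefficients of `B(σ)` are
continuous for a roll `u`, every eigenfunction in the domain `H⁴(𝕋)` is of class `C⁴`, so these are
all eigenfunctions of `B(σ)` on `L²(𝕋)`. -/
def IsBlochEigenfunction (ε ω b s : ℝ) (u : ℝ → ℝ) (σ : ℝ × ℝ) (μ : ℝ) (w : ℝ → ℂ) : Prop :=
  ContDiff ℝ 4 w ∧ Function.Periodic w (2 * Real.pi) ∧ w ≠ 0 ∧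
    ∀ x, blochOp ε ω b s u σ w x = μ * w x

/-- `ĥ(j) = (1 / 2π) ∫₀^{2π} e^{-ijx} h(x) dx`. -/
def torusCoeff (h : ℝ → ℂ) (j : ℤ) : ℂ :=
  (1 / (2 * Real.pi : ℝ) : ℂ) *
    ∫ x in (0 : ℝ)..(2 * Real.pi), Complex.exp (-(Complex.I * j * x)) * h x

/-- `‖h‖²_{H^p(𝕋)} = ∑ⱼ (1 + j²)^p |ĥ(j)|²`, possibly infinite. -/
def torusSobolevSq (p : ℕ) (h : ℝ → ℂ) : ℝ≥0∞ :=
  ∑' j : ℤ, ENNReal.ofReal ((1 + (j : ℝ) ^ 2) ^ p * ‖torusCoeff h j‖ ^ 2)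

/-- `σ ↦ W(·, σ)` is continuous from `K` to `H^p(𝕋)`. -/
def ContinuousFamilyOn (p : ℕ) (W : ℝ × ℝ → ℝ → ℂ) (K : Set (ℝ × ℝ)) : Prop :=
  ∀ σ₀ ∈ K, Tendsto (fun σ => torusSobolevSq p (fun x => W σ x - W σ₀ x)) (𝓝[K] σ₀) (𝓝 0)

/-! ### The superposition and the prefactor -/

/-- The square `I × J = [σ̄₁, σ̄₁ + c] × [σ̄₂, σ̄₂ + c]`. -/
def square (σbar : ℝ × ℝ) (c : ℝ) : Set (ℝ × ℝ) :=
  Set.Icc σbar.1 (σbar.1 + c) ×ˢ Set.Icc σbar.2 (σbar.2 + c)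

/-- `U(x, y) = ∫_K e^{i(σ₁x + σ₂y)} W(x, σ) dσ`. -/
def blochSuperposition (K : Set (ℝ × ℝ)) (W : ℝ × ℝ → ℝ → ℂ) (p : Plane) : ℂ :=
  ∫ σ in K, Complex.exp (Complex.I * (σ.1 * p 0 + σ.2 * p 1)) * W σ (p 0)

/-- `e(t) = (∫_{I × J} e^{2(λ(σ) - λ(σ̄))t} dσ)^{1/2}`. -/
def prefactor (lam : ℝ × ℝ → ℝ) (σbar : ℝ × ℝ) (c t : ℝ) : ℝ :=
  Real.sqrt (∫ σ in square σbar c, Real.exp (2 * (lam σ - lam σbar) * t))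

end RollInstability

end

noncomputable section

namespace RollInstability

/-! ### Fourier coefficients of periodic functions -/

/-! On the Fourier side the superposition decouples. At the frequency `(σ₁ + j, σ₂)` the transform
of `U` is, up to a constant, the `j`-th Fourier coefficient of `W(·, σ)`. Since `I` has length at
most `1`, almost every frequency comes from at most one pair `(j, σ)`, so different `σ` do not
interfere. The flow multiplies each mode by `e^{λ(σ)t}`, and Plancherel gives `‖V(t)‖²` as `∫_K
e^{2λ(σ)t} S(σ) dσ`, up to a constant, where `S(σ)` is comparable to `‖W(·, σ)‖²` in `H²(𝕋)`
(`sobolevNorm_two_sq`). By compactness and `W ≠ 0` these norms lie between positive constants, and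
the two-sided bound follows (`exists_sobolevNorm_bounds`).

No semigroup theory is used. The orbit is written down on the Fourier side and differentiated there
(`hasDerivAt_toLp_scaledDensity`). That it solves the equation is checked weakly: each Bloch wave
satisfies the eigenvalue equation against Schwartz functions, and Fubini integrates this over `σ`
(`linearizedOp_superposition`). Ellipticity of the symbol then gives `H⁴`. Uniqueness is an energy
estimate, because `-(1 + (1 + 2εω)∂ₓ² + ∂_y²)²` is nonpositive and the potential is bounded.

Continuity of `λ` is not assumed but derived. By symmetry of `B(σ)`, `(λ(σ) - λ(σ₀))⟨W(σ), W(σ₀)⟩ =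
⟨W(σ), (B(σ) - B(σ₀))W(σ₀)⟩ = O(|σ - σ₀|)` (`eigenvalue_sub_isBigO`). Hence `l = 1` is always
admissible in the lower bound for `e(t)`, which comes from a square of side of order `(1 +
t)^{-1/l}` at `σ̄` (`exists_prefactor_ge`). -/

theorem intervalIntegral_deriv_mul_of_periodic {f g : ℝ → ℂ} {T : ℝ} (hf : ContDiff ℝ 1 f)
    (hg : ContDiff ℝ 1 g) (hfg : Function.Periodic (fun x => f x * g x) T) :
    ∫ x in (0 : ℝ)..T, deriv f x * g x = -∫ x in (0 : ℝ)..T, f x * deriv g x := by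
  have h := intervalIntegral.integral_deriv_mul_eq_sub (a := 0) (b := T) (u := f) (v := g)
    (fun x _ => (hf.differentiable one_ne_zero x).hasDerivAt)
    (fun x _ => (hg.differentiable one_ne_zero x).hasDerivAt)
    ((hf.continuous_deriv le_rfl).intervalIntegrable _ _)
    ((hg.continuous_deriv le_rfl).intervalIntegrable _ _)
  have h0 : f T * g T = f 0 * g 0 := by simpa using hfg 0
  rw [h0, sub_self, intervalIntegral.integral_add] at h
  · linear_combination h
  · exact ((hf.continuous_deriv le_rfl).mul hg.continuous).intervalIntegrable _ _
  · exact (hf.continuous.mul (hg.continuous_deriv le_rfl)).intervalIntegrable _ _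

theorem periodic_deriv {f : ℝ → ℂ} {T : ℝ} (hf : Function.Periodic f T) :
    Function.Periodic (deriv f) T := by
  intro x
  have h : (fun y => f (y + T)) = f := funext hf
  rw [← deriv_comp_add_const, h]

theorem torusCoeff_sub {f g : ℝ → ℂ} (hf : Continuous f) (hg : Continuous g) (j : ℤ) :
    torusCoeff (fun x => f x - g x) j = torusCoeff f j - torusCoeff g j := by
  unfold torusCoeff
  rw [← mul_sub, ← intervalIntegral.integral_sub]
  · simp only [mul_sub]
  · exact Continuous.intervalIntegrable (by fun_prop) _ _
  · exact Continuous.intervalIntegrable (by fun_prop) _ _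

theorem torusCoeff_deriv {f : ℝ → ℂ} (hf : ContDiff ℝ 1 f)
    (hp : Function.Periodic f (2 * Real.pi)) (j : ℤ) :
    torusCoeff (deriv f) j = Complex.I * j * torusCoeff f j := by
  have hd : ∀ x : ℝ, HasDerivAt (fun x : ℝ => Complex.exp (-(Complex.I * j * x)))
      (-(Complex.I * j) * Complex.exp (-(Complex.I * j * x))) x := by
    intro x
    have h1 : HasDerivAt (fun x : ℝ => -(Complex.I * j * (x : ℂ))) (-(Complex.I * j)) x := by
      simpa using ((Complex.ofRealCLM.hasDerivAt (x := x)).const_mul (Complex.I * j)).fun_neg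
    simpa [mul_comm] using h1.cexp
  have he : Function.Periodic (fun x : ℝ => Complex.exp (-(Complex.I * j * x)))
      (2 * Real.pi) := by
    intro x
    rw [Complex.exp_eq_exp_iff_exists_int]
    exact ⟨-j, by push_cast; ring⟩
  have h := intervalIntegral_deriv_mul_of_periodic (T := 2 * Real.pi)
    (f := fun x : ℝ => Complex.exp (-(Complex.I * j * x))) (g := f)
    (by
      apply Complex.contDiff_exp.comp
      apply ContDiff.neg
      apply ContDiff.mul contDiff_const Complex.ofRealCLM.contDiff) hf (he.mul hp)
  simp only [fun x => (hd x).deriv] at h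
  unfold torusCoeff
  simp only [mul_assoc, neg_mul, intervalIntegral.integral_const_mul,
    intervalIntegral.integral_neg] at h ⊢
  linear_combination (1 / ((2 * Real.pi : ℝ) : ℂ)) * h

theorem norm_torusCoeff_le {f : ℝ → ℂ} {C : ℝ} (hC : ∀ x, ‖f x‖ ≤ C) (j : ℤ) :
    ‖torusCoeff f j‖ ≤ C := by
  unfold torusCoeff
  have h := intervalIntegral.norm_integral_le_of_norm_le_const (a := 0) (b := 2 * Real.pi) (C := C)
    (f := fun x : ℝ => Complex.exp (-(Complex.I * j * x)) * f x) (fun x _ => by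
      rw [norm_mul, Complex.norm_exp]
      simpa using hC x)
  have hpi := Real.pi_pos
  rw [norm_mul]
  calc _ ≤ ‖(1 / (2 * Real.pi : ℝ) : ℂ)‖ * (C * |2 * Real.pi - 0|) := by gcongr
    _ = C := by
      have h2 : |2 * Real.pi - 0| = 2 * Real.pi := by rw [sub_zero, abs_of_pos (by positivity)]
      rw [h2, norm_div, Complex.norm_real, norm_one, Real.norm_of_nonneg (by positivity)]
      field_simp

theorem exists_bound_of_periodic {f : ℝ → ℂ} (hf : Continuous f)
    (hp : Function.Periodic f (2 * Real.pi)) : ∃ C, 0 ≤ C ∧ ∀ x, ‖f x‖ ≤ C := by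
  obtain ⟨C, hC⟩ := (hp.isBounded_of_continuous (by positivity) hf).exists_norm_le
  exact ⟨C, (norm_nonneg _).trans (hC _ ⟨0, rfl⟩), fun x => hC _ ⟨x, rfl⟩⟩

theorem torusCoeff_deriv_deriv {f : ℝ → ℂ} (hf : ContDiff ℝ 2 f)
    (hp : Function.Periodic f (2 * Real.pi)) (j : ℤ) :
    torusCoeff (deriv (deriv f)) j = -((j : ℂ) ^ 2 * torusCoeff f j) := by
  have h2 : ContDiff ℝ 1 (deriv f) := (contDiff_succ_iff_deriv.1 hf).2.2
  rw [torusCoeff_deriv h2 (periodic_deriv hp),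
    torusCoeff_deriv (hf.of_le (by norm_num)) hp]
  linear_combination (j : ℂ) ^ 2 * torusCoeff f j * Complex.I_sq

theorem torusCoeff_sub_deriv_deriv {f : ℝ → ℂ} (hf : ContDiff ℝ 2 f)
    (hp : Function.Periodic f (2 * Real.pi)) (j : ℤ) :
    torusCoeff (fun x => f x - deriv (deriv f) x) j = (1 + (j : ℂ) ^ 2) * torusCoeff f j := by
  have h2 : ContDiff ℝ 1 (deriv f) := (contDiff_succ_iff_deriv.1 hf).2.2
  rw [torusCoeff_sub hf.continuous (h2.continuous_deriv le_rfl), torusCoeff_deriv_deriv hf hp]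
  ring

theorem norm_one_add_sq (j : ℤ) : ‖(1 + (j : ℂ) ^ 2)‖ = 1 + (j : ℝ) ^ 2 := by
  have h : (1 + (j : ℂ) ^ 2) = ((1 + (j : ℝ) ^ 2 : ℝ) : ℂ) := by push_cast; ring
  rw [h, Complex.norm_real, Real.norm_of_nonneg (by positivity)]

theorem exists_norm_torusCoeff_le_of_contDiff_two {f : ℝ → ℂ} (hf : ContDiff ℝ 2 f)
    (hp : Function.Periodic f (2 * Real.pi)) :
    ∃ C, 0 ≤ C ∧ ∀ j : ℤ, (1 + (j : ℝ) ^ 2) * ‖torusCoeff f j‖ ≤ C := by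
  have h2 : ContDiff ℝ 1 (deriv f) := (contDiff_succ_iff_deriv.1 hf).2.2
  obtain ⟨C, hC0, hC⟩ := exists_bound_of_periodic
    (f := fun x => f x - deriv (deriv f) x)
    (hf.continuous.sub (h2.continuous_deriv le_rfl))
    (hp.sub (periodic_deriv (periodic_deriv hp)))
  refine ⟨C, hC0, fun j => ?_⟩
  have h := norm_torusCoeff_le hC j
  rwa [torusCoeff_sub_deriv_deriv hf hp, norm_mul, norm_one_add_sq] at h

/-- Passing from `f` to `f - f''` multiplies the coefficients by `1 + j²`, so applying the `C²`
bound to `f - f''` gains the second factor. -/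
theorem exists_norm_torusCoeff_le_of_contDiff_four {f : ℝ → ℂ} (hf : ContDiff ℝ 4 f)
    (hp : Function.Periodic f (2 * Real.pi)) :
    ∃ C, 0 ≤ C ∧ ∀ j : ℤ, (1 + (j : ℝ) ^ 2) ^ 2 * ‖torusCoeff f j‖ ≤ C := by
  have h3 : ContDiff ℝ 3 (deriv f) := (contDiff_succ_iff_deriv (n := 3).1 hf).2.2
  have h2 : ContDiff ℝ 2 (deriv (deriv f)) := (contDiff_succ_iff_deriv (n := 2).1 h3).2.2
  have hf2 : ContDiff ℝ 2 f := hf.of_le (by norm_num)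
  obtain ⟨C, hC0, hC⟩ := exists_norm_torusCoeff_le_of_contDiff_two
    (f := fun x => f x - deriv (deriv f) x) (hf2.sub h2)
    (hp.sub (periodic_deriv (periodic_deriv hp)))
  refine ⟨C, hC0, fun j => ?_⟩
  have h := hC j
  rw [torusCoeff_sub_deriv_deriv hf2 hp, norm_mul, norm_one_add_sq] at h
  linarith

theorem summable_inv_one_add_sq : Summable (fun j : ℤ => (1 + (j : ℝ) ^ 2)⁻¹) := by
  have h : Summable (fun j : ℤ => 1 / (j : ℝ) ^ 2) := Real.summable_one_div_int_pow.2 one_lt_two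
  refine Summable.of_norm_bounded_eventually (h.add (summable_of_ne_finset_zero (s := {0})
    (f := fun j : ℤ => if j = 0 then (1 : ℝ) else 0) (by simp +contextual))) ?_
  refine Eventually.of_forall fun j => ?_
  rw [Real.norm_of_nonneg (by positivity)]
  by_cases hj : j = 0
  · simp [hj]
  · simp only [hj, if_false, add_zero, one_div]
    have : (0 : ℝ) < (j : ℝ) ^ 2 := by positivity
    gcongr
    linarith

/-- The Fourier series of a periodic function with summable coefficients. -/
theorem hasSum_torusCoeff {f : ℝ → ℂ} (hf : Continuous f)
    (hp : Function.Periodic f (2 * Real.pi)) (hs : Summable (torusCoeff f)) (x : ℝ) :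
    HasSum (fun j : ℤ => torusCoeff f j * Complex.exp (Complex.I * j * x)) (f x) := by
  have : Fact (0 < 2 * Real.pi) := ⟨by positivity⟩
  let F : C(AddCircle (2 * Real.pi), ℂ) := ⟨hp.lift, continuous_coinduced_dom.mpr hf⟩
  have hF : ∀ y : ℝ, F (y : AddCircle (2 * Real.pi)) = f y := fun y => hp.lift_coe y
  have hpi : (Real.pi : ℂ) ≠ 0 := by exact_mod_cast Real.pi_ne_zero
  have hcoef : ∀ j, fourierCoeff F j = torusCoeff f j := by
    intro j
    rw [fourierCoeff_eq_intervalIntegral _ _ 0, torusCoeff, zero_add, Complex.real_smul]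
    congr 1
    · push_cast; rfl
    · refine intervalIntegral.integral_congr fun y _ => ?_
      simp only [hF, fourier_coe_apply, smul_eq_mul]
      congr 2
      push_cast
      field_simp
  have h := has_pointwise_sum_fourier_series_of_summable (f := F)
    (by rwa [funext hcoef]) (x : AddCircle (2 * Real.pi))
  simp only [hcoef, hF, fourier_coe_apply, smul_eq_mul] at h
  convert h using 4 with j
  push_cast
  field_simp

/-! ### Families of periodic functions that are continuous with values in `H²` -/

theorem torusSobolevSq_two_eq {f : ℝ → ℂ} (X : lp (fun _ : ℤ => ℂ) 2)
    (hX : ∀ j, X j = (1 + (j : ℂ) ^ 2) * torusCoeff f j) :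
    torusSobolevSq 2 f = ENNReal.ofReal (‖X‖ ^ 2) := by
  have h2 : (0 : ℝ) < (2 : ℝ≥0∞).toReal := by norm_num
  have hs : HasSum (fun j => ‖X j‖ ^ 2) (‖X‖ ^ 2) := by
    have := lp.hasSum_norm h2 X
    simpa using this
  rw [torusSobolevSq, ← hs.tsum_eq, ENNReal.ofReal_tsum_of_nonneg (fun _ => by positivity)
    hs.summable]
  refine tsum_congr fun j => ?_
  rw [hX, norm_mul, norm_one_add_sq, mul_pow]

/-- The quartic decay leaves a factor `(1 + j²)⁻¹` after weighting, which is square summable. -/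
theorem memℓp_weighted_torusCoeff {f : ℝ → ℂ} (hf : ContDiff ℝ 4 f)
    (hp : Function.Periodic f (2 * Real.pi)) :
    Memℓp (fun j : ℤ => (1 + (j : ℂ) ^ 2) * torusCoeff f j) 2 := by
  obtain ⟨C, hC0, hC⟩ := exists_norm_torusCoeff_le_of_contDiff_four hf hp
  rw [memℓp_gen_iff (by norm_num)]
  refine Summable.of_nonneg_of_le (fun j => by positivity) (fun j => ?_)
    (summable_inv_one_add_sq.mul_left (C ^ 2))
  have h1 : (0 : ℝ) < 1 + (j : ℝ) ^ 2 := by positivity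
  have h2 : (1 + (j : ℝ) ^ 2) * ‖torusCoeff f j‖ ≤ C * (1 + (j : ℝ) ^ 2)⁻¹ := by
    rw [← div_eq_mul_inv, le_div_iff₀ h1]
    linarith [hC j]
  rw [norm_mul, norm_one_add_sq]
  simp only [ENNReal.toReal_ofNat, Real.rpow_ofNat]
  calc _ ≤ (C * (1 + (j : ℝ) ^ 2)⁻¹) ^ 2 := by gcongr
    _ = C ^ 2 * ((1 + (j : ℝ) ^ 2)⁻¹ * (1 + (j : ℝ) ^ 2)⁻¹) := by ring
    _ ≤ C ^ 2 * ((1 + (j : ℝ) ^ 2)⁻¹ * 1) := by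
      gcongr
      exact inv_le_one_of_one_le₀ (by nlinarith)
    _ = _ := by ring

/-- Identifies `H²(𝕋)` with `ℓ²` through the weight `1 + j²`. The continuity hypothesis becomes norm
continuity of a map into a normed space, to which compactness of `K` applies. -/
theorem exists_continuousOn_weighted_torusCoeff {K : Set (ℝ × ℝ)} {W : ℝ × ℝ → ℝ → ℂ}
    (hd : ∀ σ ∈ K, ContDiff ℝ 4 (W σ)) (hp : ∀ σ ∈ K, Function.Periodic (W σ) (2 * Real.pi))
    (hc : ContinuousFamilyOn 2 W K) :
    ∃ X : ℝ × ℝ → lp (fun _ : ℤ => ℂ) 2, ContinuousOn X K ∧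
      ∀ σ ∈ K, ∀ j, X σ j = (1 + (j : ℂ) ^ 2) * torusCoeff (W σ) j := by
  classical
  let X : ℝ × ℝ → lp (fun _ : ℤ => ℂ) 2 := fun σ =>
    if h : σ ∈ K then ⟨_, memℓp_weighted_torusCoeff (hd σ h) (hp σ h)⟩ else 0
  have hX : ∀ σ ∈ K, ∀ j, X σ j = (1 + (j : ℂ) ^ 2) * torusCoeff (W σ) j := by
    intro σ h j
    simp [X, h]
  refine ⟨X, fun σ₀ h₀ => ?_, hX⟩
  rw [ContinuousWithinAt, tendsto_iff_norm_sub_tendsto_zero]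
  have h1 := (ENNReal.tendsto_toReal ENNReal.zero_ne_top).comp (hc σ₀ h₀)
  have h2 := (Real.continuous_sqrt.tendsto _).comp h1
  simp only [ENNReal.toReal_zero, Real.sqrt_zero] at h2
  refine h2.congr' ?_
  filter_upwards [self_mem_nhdsWithin] with σ hσ
  have h3 : torusSobolevSq 2 (fun x => W σ x - W σ₀ x) = ENNReal.ofReal (‖X σ - X σ₀‖ ^ 2) := by
    refine torusSobolevSq_two_eq _ fun j => ?_
    rw [torusCoeff_sub (hd σ hσ).continuous (hd σ₀ h₀).continuous, lp.coeFn_sub, Pi.sub_apply,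
      hX σ hσ, hX σ₀ h₀]
    ring
  simp only [Function.comp_apply, h3]
  rw [ENNReal.toReal_ofReal (by positivity), Real.sqrt_sq (norm_nonneg _)]

theorem norm_torusCoeff_le_of_weighted {f : ℝ → ℂ} (X : lp (fun _ : ℤ => ℂ) 2)
    (hX : ∀ j, X j = (1 + (j : ℂ) ^ 2) * torusCoeff f j) (j : ℤ) :
    ‖torusCoeff f j‖ ≤ ‖X‖ * (1 + (j : ℝ) ^ 2)⁻¹ := by
  have h := lp.norm_apply_le_norm (by norm_num) X j
  rw [hX, norm_mul, norm_one_add_sq] at h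
  rw [← div_eq_mul_inv, le_div_iff₀ (by positivity)]
  linarith

/-- The consequences of continuity in `H²` on a compact set that are used below. -/
theorem exists_bounds_of_continuousFamilyOn {K : Set (ℝ × ℝ)} (hK : IsCompact K)
    {W : ℝ × ℝ → ℝ → ℂ}
    (hd : ∀ σ ∈ K, ContDiff ℝ 4 (W σ)) (hp : ∀ σ ∈ K, Function.Periodic (W σ) (2 * Real.pi))
    (h0 : ∀ σ ∈ K, W σ ≠ 0) (hc : ContinuousFamilyOn 2 W K) :
    (∃ A B : ℝ, 0 < A ∧ 0 < B ∧ ∀ σ ∈ K, ENNReal.ofReal A ≤ torusSobolevSq 2 (W σ) ∧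
      torusSobolevSq 2 (W σ) ≤ ENNReal.ofReal B) ∧
    (∃ D : ℝ, 0 ≤ D ∧ ∀ σ ∈ K, ∀ j, ‖torusCoeff (W σ) j‖ ≤ D * (1 + (j : ℝ) ^ 2)⁻¹) ∧
    (∀ j, ContinuousOn (fun σ => torusCoeff (W σ) j) K) := by
  obtain ⟨X, hXc, hX⟩ := exists_continuousOn_weighted_torusCoeff hd hp hc
  obtain ⟨D, hD⟩ := (hK.image_of_continuousOn hXc).isBounded.exists_norm_le
  have hD' : ∀ σ ∈ K, ‖X σ‖ ≤ |D| := fun σ hσ => (hD _ ⟨σ, hσ, rfl⟩).trans (le_abs_self D)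
  have hD1 : ∀ σ ∈ K, ∀ j, ‖torusCoeff (W σ) j‖ ≤ |D| * (1 + (j : ℝ) ^ 2)⁻¹ := by
    intro σ hσ j
    refine (norm_torusCoeff_le_of_weighted (X σ) (hX σ hσ) j).trans ?_
    gcongr
    exact hD' σ hσ
  refine ⟨?_, ⟨|D|, abs_nonneg D, hD1⟩, ?_⟩
  · have hpos : ∀ σ ∈ K, 0 < ‖X σ‖ := by
      intro σ hσ
      rw [norm_pos_iff]
      intro h
      have hz : ∀ j, torusCoeff (W σ) j = 0 := by
        intro j
        have := norm_torusCoeff_le_of_weighted (X σ) (hX σ hσ) j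
        rwa [h, norm_zero, zero_mul, norm_le_zero_iff] at this
      refine h0 σ hσ (funext fun x => ?_)
      have hs := hasSum_torusCoeff (hd σ hσ).continuous (hp σ hσ)
        (by rw [funext hz]; exact summable_zero) x
      simp only [hz, zero_mul] at hs
      exact hs.unique hasSum_zero
    have hA : ∃ A : ℝ, 0 < A ∧ ∀ σ ∈ K, A ≤ ‖X σ‖ := by
      rcases K.eq_empty_or_nonempty with rfl | hne
      · exact ⟨1, one_pos, by simp⟩
      · obtain ⟨σ₀, h₀, hm⟩ := hK.exists_isMinOn hne hXc.norm
        exact ⟨_, hpos σ₀ h₀, fun σ hσ => hm hσ⟩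
    obtain ⟨A, hA0, hA⟩ := hA
    -- The `+ 1` only keeps the upper constant positive when `D = 0`.
    refine ⟨A ^ 2, D ^ 2 + 1, by positivity, by positivity, fun σ hσ => ?_⟩
    rw [torusSobolevSq_two_eq (X σ) (hX σ hσ)]
    constructor
    · have := hA σ hσ
      gcongr
    · apply ENNReal.ofReal_le_ofReal
      have := hD' σ hσ
      rw [← sq_abs D]
      nlinarith [norm_nonneg (X σ)]
  · intro j
    have h1 : ContinuousOn (fun σ => X σ j) K := by
      have h2 : Continuous (fun Y : lp (fun _ : ℤ => ℂ) 2 => Y j) :=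
        (continuous_apply j).comp lp.uniformContinuous_coe.continuous
      exact h2.comp_continuousOn hXc
    have hne : (1 + (j : ℂ) ^ 2) ≠ 0 := by
      rw [← norm_ne_zero_iff, norm_one_add_sq]; positivity
    refine (h1.const_mul ((1 + (j : ℂ) ^ 2)⁻¹)).congr fun σ hσ => ?_
    simp only [hX σ hσ]
    field_simp

/-- Weierstrass M-test: the bound `D / (1 + j²)` is summable and uniform in `σ` and `x`, so the
Fourier series converges uniformly to a jointly continuous, bounded function. -/
theorem continuousOn_uncurry_of_torusCoeff {K : Set (ℝ × ℝ)} {W : ℝ × ℝ → ℝ → ℂ} {D : ℝ}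
    (hd : ∀ σ ∈ K, ContDiff ℝ 4 (W σ)) (hp : ∀ σ ∈ K, Function.Periodic (W σ) (2 * Real.pi))
    (hD : ∀ σ ∈ K, ∀ j : ℤ, ‖torusCoeff (W σ) j‖ ≤ D * (1 + (j : ℝ) ^ 2)⁻¹)
    (hc : ∀ j, ContinuousOn (fun σ => torusCoeff (W σ) j) K) :
    (∀ σ ∈ K, ∀ x : ℝ,
      HasSum (fun j : ℤ => torusCoeff (W σ) j * Complex.exp (Complex.I * j * x)) (W σ x)) ∧
    ContinuousOn (fun z : (ℝ × ℝ) × ℝ => W z.1 z.2) (K ×ˢ Set.univ) ∧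
    ∃ D', 0 ≤ D' ∧ ∀ σ ∈ K, ∀ x, ‖W σ x‖ ≤ D' := by
  have hsum : Summable (fun j : ℤ => D * (1 + (j : ℝ) ^ 2)⁻¹) := summable_inv_one_add_sq.mul_left D
  have hexp : ∀ (j : ℤ) (x : ℝ), ‖Complex.exp (Complex.I * j * x)‖ = 1 := by
    intro j x
    rw [Complex.norm_exp]; simp
  have hs : ∀ σ ∈ K, ∀ x : ℝ,
      HasSum (fun j : ℤ => torusCoeff (W σ) j * Complex.exp (Complex.I * j * x)) (W σ x) :=
    fun σ hσ x => hasSum_torusCoeff (hd σ hσ).continuous (hp σ hσ)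
      (Summable.of_norm_bounded hsum (hD σ hσ)) x
  refine ⟨hs, ?_, |∑' j : ℤ, D * (1 + (j : ℝ) ^ 2)⁻¹|, abs_nonneg _, fun σ hσ x => ?_⟩
  · have h : ContinuousOn (fun z : (ℝ × ℝ) × ℝ =>
        ∑' j : ℤ, torusCoeff (W z.1) j * Complex.exp (Complex.I * j * z.2)) (K ×ˢ Set.univ) := by
      refine continuousOn_tsum (fun j => ?_) hsum fun j z hz => ?_
      · refine ((hc j).comp continuousOn_fst fun z hz => hz.1).mul ?_
        fun_prop
      · rw [norm_mul, hexp, mul_one]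
        exact hD z.1 hz.1 j
    exact h.congr fun z hz => (hs z.1 hz.1 z.2).tsum_eq.symm
  · rw [← (hs σ hσ x).tsum_eq]
    refine (tsum_of_norm_bounded hsum.hasSum fun j => ?_).trans (le_abs_self _)
    rw [norm_mul, hexp, mul_one]
    exact hD σ hσ j

/-! ### Symmetry of the Bloch operators and regularity of the eigenvalue -/

theorem contDiff_blochDeriv {n : ℕ} {f : ℝ → ℂ} (hf : ContDiff ℝ (n + 1) f) (σ : ℝ × ℝ) :
    ContDiff ℝ n (blochDeriv σ f) :=
  (contDiff_succ_iff_deriv.1 hf).2.2.add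
    (contDiff_const.mul (hf.of_le (by exact_mod_cast Nat.le_succ n)))

theorem periodic_blochDeriv {f : ℝ → ℂ} {T : ℝ} (hf : Function.Periodic f T) (σ : ℝ × ℝ) :
    Function.Periodic (blochDeriv σ f) T := by
  intro x
  simp only [blochDeriv, periodic_deriv hf x, hf x]

theorem contDiff_blochInner {n : ℕ} {f : ℝ → ℂ} (hf : ContDiff ℝ (n + 2) f) (ε ω : ℝ)
    (σ : ℝ × ℝ) : ContDiff ℝ n (blochInner ε ω σ f) := by
  have hn : ContDiff ℝ n f := hf.of_le (by exact_mod_cast Nat.le_add_right n 2)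
  have h1 : ContDiff ℝ (n + 1 : ℕ) (blochDeriv σ f) :=
    contDiff_blochDeriv (n := n + 1) (by push_cast; rw [add_assoc]; exact hf) σ
  have h2 : ContDiff ℝ n (blochDeriv σ (blochDeriv σ f)) :=
    contDiff_blochDeriv (by exact_mod_cast h1) σ
  exact (hn.add (contDiff_const.mul h2)).sub (contDiff_const.mul hn)

theorem periodic_blochInner {f : ℝ → ℂ} {T : ℝ} (hf : Function.Periodic f T) (ε ω : ℝ)
    (σ : ℝ × ℝ) : Function.Periodic (blochInner ε ω σ f) T := by
  intro x
  simp only [blochInner, periodic_blochDeriv (periodic_blochDeriv hf σ) σ x, hf x]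

/-- Skew-adjointness: `∂ₓ` changes sign by periodic integration by parts, `iσ₁` by conjugation. The
Bloch operator contains only even powers of `∂ₓ + iσ₁`, which makes it symmetric. -/
theorem integral_blochDeriv_mul_conj {f g : ℝ → ℂ} (hf : ContDiff ℝ 1 f) (hg : ContDiff ℝ 1 g)
    (hfp : Function.Periodic f (2 * Real.pi)) (hgp : Function.Periodic g (2 * Real.pi))
    (σ : ℝ × ℝ) :
    ∫ x in (0 : ℝ)..(2 * Real.pi), blochDeriv σ f x * star (g x) =
      -∫ x in (0 : ℝ)..(2 * Real.pi), f x * star (blochDeriv σ g x) := by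
  have hg' : ContDiff ℝ 1 (fun x => star (g x)) := (starL' ℝ (A := ℂ)).contDiff.comp hg
  have hper : Function.Periodic (fun x => f x * star (g x)) (2 * Real.pi) := by
    intro x
    simp only [hfp x, hgp x]
  have h := intervalIntegral_deriv_mul_of_periodic hf hg' hper
  have hd : ∀ x, deriv (fun x => star (g x)) x = star (deriv g x) := fun x => deriv.star ..
  simp only [hd] at h
  have hf0 := hf.continuous
  have hg0 := hg.continuous
  have hf1 := hf.continuous_deriv le_rfl
  have hg1 := hg.continuous_deriv le_rfl
  simp only [blochDeriv, add_mul, star_add, mul_add]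
  rw [intervalIntegral.integral_add (Continuous.intervalIntegrable (by fun_prop) _ _)
    (Continuous.intervalIntegrable (by fun_prop) _ _), h,
    intervalIntegral.integral_add (Continuous.intervalIntegrable (by fun_prop) _ _)
    (Continuous.intervalIntegrable (by fun_prop) _ _), neg_add, ← intervalIntegral.integral_neg,
    ← intervalIntegral.integral_neg]
  congr 1
  refine intervalIntegral.integral_congr fun x _ => ?_
  simp only [star_mul', Complex.star_def, Complex.conj_I, Complex.conj_ofReal]
  ring

theorem integral_blochInner_mul_conj {f g : ℝ → ℂ} (hf : ContDiff ℝ 2 f) (hg : ContDiff ℝ 2 g)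
    (hfp : Function.Periodic f (2 * Real.pi)) (hgp : Function.Periodic g (2 * Real.pi))
    (ε ω : ℝ) (σ : ℝ × ℝ) :
    ∫ x in (0 : ℝ)..(2 * Real.pi), blochInner ε ω σ f x * star (g x) =
      ∫ x in (0 : ℝ)..(2 * Real.pi), f x * star (blochInner ε ω σ g x) := by
  have hf1 : ContDiff ℝ 1 (blochDeriv σ f) := contDiff_blochDeriv (n := 1) (by exact_mod_cast hf) σ
  have hg1 : ContDiff ℝ 1 (blochDeriv σ g) := contDiff_blochDeriv (n := 1) (by exact_mod_cast hg) σ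
  have hf2 : ContDiff ℝ 0 (blochDeriv σ (blochDeriv σ f)) :=
    contDiff_blochDeriv (n := 0) (by exact_mod_cast hf1) σ
  have hg2 : ContDiff ℝ 0 (blochDeriv σ (blochDeriv σ g)) :=
    contDiff_blochDeriv (n := 0) (by exact_mod_cast hg1) σ
  have hf01 : ContDiff ℝ 1 f := hf.of_le (by norm_num)
  have hg01 : ContDiff ℝ 1 g := hg.of_le (by norm_num)
  have hfc := hf.continuous
  have hgc := hg.continuous
  have hf2c := hf2.continuous
  have hg2c := hg2.continuous
  have h : ∫ x in (0 : ℝ)..(2 * Real.pi), blochDeriv σ (blochDeriv σ f) x * star (g x) =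
      ∫ x in (0 : ℝ)..(2 * Real.pi), f x * star (blochDeriv σ (blochDeriv σ g) x) := by
    rw [integral_blochDeriv_mul_conj hf1 hg01 (periodic_blochDeriv hfp σ) hgp,
      integral_blochDeriv_mul_conj hf01 hg1 hfp (periodic_blochDeriv hgp σ), neg_neg]
  have e1 : ∀ x, blochInner ε ω σ f x * star (g x) =
      (1 - (σ.2 : ℂ) ^ 2) * (f x * star (g x)) +
        ((1 + 2 * ε * ω : ℝ) : ℂ) * (blochDeriv σ (blochDeriv σ f) x * star (g x)) := by
    intro x
    simp only [blochInner]
    ring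
  have e2 : ∀ x, f x * star (blochInner ε ω σ g x) =
      (1 - (σ.2 : ℂ) ^ 2) * (f x * star (g x)) +
        ((1 + 2 * ε * ω : ℝ) : ℂ) * (f x * star (blochDeriv σ (blochDeriv σ g) x)) := by
    intro x
    simp only [blochInner, star_add, star_sub, star_mul', Complex.star_def, Complex.conj_ofReal,
      map_pow]
    ring
  simp only [e1, e2]
  rw [intervalIntegral.integral_add (Continuous.intervalIntegrable (by fun_prop) _ _)
    (Continuous.intervalIntegrable (by fun_prop) _ _),
    intervalIntegral.integral_add (Continuous.intervalIntegrable (by fun_prop) _ _)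
    (Continuous.intervalIntegrable (by fun_prop) _ _),
    intervalIntegral.integral_const_mul, intervalIntegral.integral_const_mul,
    intervalIntegral.integral_const_mul, h]

theorem continuous_potential {u : ℝ → ℝ} (hu : Continuous u) (ε b s : ℝ) :
    Continuous (potential ε b s u) := by
  unfold potential
  fun_prop

theorem integral_blochOp_mul_conj {u : ℝ → ℝ} (hu : Continuous u) {f g : ℝ → ℂ}
    (hf : ContDiff ℝ 4 f) (hg : ContDiff ℝ 4 g)
    (hfp : Function.Periodic f (2 * Real.pi)) (hgp : Function.Periodic g (2 * Real.pi))
    (ε ω b s : ℝ) (σ : ℝ × ℝ) :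
    ∫ x in (0 : ℝ)..(2 * Real.pi), blochOp ε ω b s u σ f x * star (g x) =
      ∫ x in (0 : ℝ)..(2 * Real.pi), f x * star (blochOp ε ω b s u σ g x) := by
  have hf2 : ContDiff ℝ 2 f := hf.of_le (by norm_num)
  have hg2 : ContDiff ℝ 2 g := hg.of_le (by norm_num)
  have hPf : ContDiff ℝ 2 (blochInner ε ω σ f) :=
    contDiff_blochInner (n := 2) (by norm_num; exact hf) ε ω σ
  have hPg : ContDiff ℝ 2 (blochInner ε ω σ g) :=
    contDiff_blochInner (n := 2) (by norm_num; exact hg) ε ω σ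
  have hPPf : ContDiff ℝ 0 (blochInner ε ω σ (blochInner ε ω σ f)) :=
    contDiff_blochInner (n := 0) (by norm_num; exact hPf) ε ω σ
  have hPPg : ContDiff ℝ 0 (blochInner ε ω σ (blochInner ε ω σ g)) :=
    contDiff_blochInner (n := 0) (by norm_num; exact hPg) ε ω σ
  have hfc := hf.continuous
  have hgc := hg.continuous
  have hf2c := hPPf.continuous
  have hg2c := hPPg.continuous
  have hq := continuous_potential hu ε b s
  have hpf := periodic_blochInner hfp ε ω σ
  have hpg := periodic_blochInner hgp ε ω σ
  have h : ∫ x in (0 : ℝ)..(2 * Real.pi), blochInner ε ω σ (blochInner ε ω σ f) x * star (g x) =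
      ∫ x in (0 : ℝ)..(2 * Real.pi), f x * star (blochInner ε ω σ (blochInner ε ω σ g) x) := by
    rw [integral_blochInner_mul_conj hPf hg2 hpf hgp, integral_blochInner_mul_conj hf2 hPg hfp hpg]
  have e1 : ∀ x, blochOp ε ω b s u σ f x * star (g x) =
      (potential ε b s u x : ℂ) * (f x * star (g x)) -
        (blochInner ε ω σ (blochInner ε ω σ f) x * star (g x)) := by
    intro x
    simp only [blochOp]
    ring
  have e2 : ∀ x, f x * star (blochOp ε ω b s u σ g x) =
      (potential ε b s u x : ℂ) * (f x * star (g x)) -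
        (f x * star (blochInner ε ω σ (blochInner ε ω σ g) x)) := by
    intro x
    simp only [blochOp, star_add, star_neg, star_mul', Complex.star_def, Complex.conj_ofReal]
    ring
  simp only [e1, e2]
  rw [intervalIntegral.integral_sub (Continuous.intervalIntegrable (by fun_prop) _ _)
    (Continuous.intervalIntegrable (by fun_prop) _ _),
    intervalIntegral.integral_sub (Continuous.intervalIntegrable (by fun_prop) _ _)
    (Continuous.intervalIntegrable (by fun_prop) _ _), h]

/-! ### Dependence of the Bloch operators and their eigenvalues on `σ` -/

theorem deriv_linear_combination {a b c : ℂ} {f g h : ℝ → ℂ} (hf : Differentiable ℝ f)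
    (hg : Differentiable ℝ g) (hh : Differentiable ℝ h) :
    deriv (fun x => a * f x + b * g x + c * h x) =
      fun x => a * deriv f x + b * deriv g x + c * deriv h x := by
  funext x
  exact ((((hf x).hasDerivAt.const_mul a).add ((hg x).hasDerivAt.const_mul b)).add
    ((hh x).hasDerivAt.const_mul c)).deriv

/-- Separates parameter and function: `σ` enters only through polynomial scalar coefficients in
front of fixed derivatives of `f`. This makes `(B(σ) - B(σ₀))f` of order `|σ - σ₀|`. -/
theorem blochInner_eq {f : ℝ → ℂ} (hf : ContDiff ℝ 2 f) (ε ω : ℝ) (σ : ℝ × ℝ) :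
    blochInner ε ω σ f = fun x =>
      (1 - ((1 + 2 * ε * ω : ℝ) : ℂ) * (σ.1 : ℂ) ^ 2 - (σ.2 : ℂ) ^ 2) * f x +
      (2 * Complex.I * ((1 + 2 * ε * ω : ℝ) : ℂ) * σ.1) * deriv f x +
      ((1 + 2 * ε * ω : ℝ) : ℂ) * deriv (deriv f) x := by
  have h1 : Differentiable ℝ f := hf.differentiable two_ne_zero
  have h2 : Differentiable ℝ (deriv f) :=
    (contDiff_succ_iff_deriv (n := 1).1 hf).2.2.differentiable one_ne_zero
  have hd : deriv (blochDeriv σ f) = fun x => deriv (deriv f) x + Complex.I * σ.1 * deriv f x := by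
    funext x
    exact ((h2 x).hasDerivAt.add ((h1 x).hasDerivAt.const_mul _)).deriv
  funext x
  rw [blochInner, blochDeriv, hd]
  simp only [blochDeriv]
  linear_combination ((1 + 2 * ε * ω : ℝ) : ℂ) * (σ.1 : ℂ) ^ 2 * f x * Complex.I_sq

/-- The coefficients of `(1 + (1 + 2εω)(∂ₓ + iσ₁)² - σ₂²)²` as a differential operator. -/
theorem blochOp_eq {w : ℝ → ℂ} (hw : ContDiff ℝ 4 w) (ε ω b s : ℝ) (u : ℝ → ℝ) (σ : ℝ × ℝ)
    {α β κ : ℂ} (hα : α = 1 - ((1 + 2 * ε * ω : ℝ) : ℂ) * (σ.1 : ℂ) ^ 2 - (σ.2 : ℂ) ^ 2)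
    (hβ : β = 2 * Complex.I * ((1 + 2 * ε * ω : ℝ) : ℂ) * σ.1)
    (hκ : κ = ((1 + 2 * ε * ω : ℝ) : ℂ)) (x : ℝ) :
    blochOp ε ω b s u σ w x = (potential ε b s u x : ℂ) * w x -
      (α ^ 2 * w x + 2 * α * β * deriv w x + (2 * α * κ + β ^ 2) * deriv (deriv w) x +
        2 * β * κ * deriv (deriv (deriv w)) x + κ ^ 2 * deriv (deriv (deriv (deriv w))) x) := by
  have hw2 : ContDiff ℝ 2 w := hw.of_le (by norm_num)
  have h3 : ContDiff ℝ 3 (deriv w) := (contDiff_succ_iff_deriv (n := 3).1 hw).2.2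
  have h2 : ContDiff ℝ 2 (deriv (deriv w)) := (contDiff_succ_iff_deriv (n := 2).1 h3).2.2
  have h1 : ContDiff ℝ 1 (deriv (deriv (deriv w))) := (contDiff_succ_iff_deriv (n := 1).1 h2).2.2
  have d0 := hw.differentiable (by norm_num)
  have d1 := h3.differentiable (by norm_num)
  have d2 := h2.differentiable (by norm_num)
  have d3 := h1.differentiable (by norm_num)
  have hP : ContDiff ℝ 2 (blochInner ε ω σ w) :=
    contDiff_blochInner (n := 2) (by norm_num; exact hw) ε ω σ
  have hPe := blochInner_eq hw2 ε ω σ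
  rw [← hα, ← hβ, ← hκ] at hPe
  rw [blochOp, blochInner_eq hP, ← hα, ← hβ, ← hκ, hPe, deriv_linear_combination d0 d1 d2,
    deriv_linear_combination d1 d2 d3]
  ring

/-- An eigenvalue with eigenfunctions depending continuously on `σ` is Lipschitz at every point. -/
theorem eigenvalue_sub_isBigO {ε ω b s : ℝ} {u : ℝ → ℝ} (hu : Continuous u) {K : Set (ℝ × ℝ)}
    {lam : ℝ × ℝ → ℝ} {W : ℝ × ℝ → ℝ → ℂ}
    (hW : ∀ σ ∈ K, IsBlochEigenfunction ε ω b s u σ (lam σ) (W σ))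
    (hc : ContinuousOn (fun z : (ℝ × ℝ) × ℝ => W z.1 z.2) (K ×ˢ Set.univ)) {D : ℝ}
    (hD : ∀ σ ∈ K, ∀ x, ‖W σ x‖ ≤ D) {σ₀ : ℝ × ℝ} (h₀ : σ₀ ∈ K) :
    (fun σ => lam σ - lam σ₀) =O[𝓝[K] σ₀] (fun σ => σ - σ₀) := by
  obtain ⟨hw, hwp, hw0, hwe⟩ := hW σ₀ h₀
  set w := W σ₀ with hw_def
  let κ : ℂ := ((1 + 2 * ε * ω : ℝ) : ℂ)
  let α : ℝ × ℝ → ℂ := fun σ => 1 - κ * (σ.1 : ℂ) ^ 2 - (σ.2 : ℂ) ^ 2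
  let β : ℝ × ℝ → ℂ := fun σ => 2 * Complex.I * κ * σ.1
  have h3 : ContDiff ℝ 3 (deriv w) := (contDiff_succ_iff_deriv (n := 3).1 hw).2.2
  have h2 : ContDiff ℝ 2 (deriv (deriv w)) := (contDiff_succ_iff_deriv (n := 2).1 h3).2.2
  have h1 : ContDiff ℝ 1 (deriv (deriv (deriv w))) := (contDiff_succ_iff_deriv (n := 1).1 h2).2.2
  have c0 := hw.continuous
  have c1 := h3.continuous
  have c2 := h2.continuous
  have c3 := h1.continuous
  -- The pairing of `W σ` with a fixed function `g`; it is continuous at `σ₀` by dominated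
  -- convergence.
  let J : (ℝ → ℂ) → ℝ × ℝ → ℂ := fun g σ => ∫ x in (0 : ℝ)..(2 * Real.pi), W σ x * star (g x)
  have hJ : ∀ g : ℝ → ℂ, Continuous g → ContinuousWithinAt (J g) K σ₀ := by
    intro g hg
    refine intervalIntegral.continuousWithinAt_of_dominated_interval (bound := fun x => D * ‖g x‖)
      ?_ ?_ ?_ ?_
    · filter_upwards [self_mem_nhdsWithin] with σ hσ
      have := (hW σ hσ).1.continuous
      exact Continuous.aestronglyMeasurable (by fun_prop)
    · filter_upwards [self_mem_nhdsWithin] with σ hσ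
      refine Eventually.of_forall fun x _ => ?_
      rw [norm_mul, norm_star]
      gcongr
      exact hD σ hσ x
    · exact Continuous.intervalIntegrable (by fun_prop) _ _
    · refine Eventually.of_forall fun x _ => ?_
      refine ContinuousWithinAt.mul ?_ continuousWithinAt_const
      exact (hc (σ₀, x) ⟨h₀, Set.mem_univ x⟩).comp (f := fun σ => (σ, x))
        (by fun_prop) (fun σ hσ => ⟨hσ, Set.mem_univ x⟩)
  have hJ0 : J w σ₀ ≠ 0 := by
    have hpos : 0 < ∫ x in (0 : ℝ)..(2 * Real.pi), ‖w x‖ ^ 2 := by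
      have hpi : (0 : ℝ) < 2 * Real.pi := by positivity
      refine intervalIntegral.integral_pos hpi (by fun_prop) (fun x _ => by positivity) ?_
      obtain ⟨y, hy⟩ := Function.ne_iff.1 hw0
      obtain ⟨z, hz, hyz⟩ := hwp.exists_mem_Ico₀ hpi y
      refine ⟨z, Set.Ico_subset_Icc_self hz, ?_⟩
      rw [← hyz]
      have := norm_pos_iff.2 hy
      positivity
    have : J w σ₀ = ((∫ x in (0 : ℝ)..(2 * Real.pi), ‖w x‖ ^ 2 : ℝ) : ℂ) := by
      rw [← intervalIntegral.integral_ofReal]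
      refine intervalIntegral.integral_congr fun x _ => ?_
      simp only [← hw_def, Complex.star_def, Complex.mul_conj, Complex.normSq_eq_norm_sq]
    rw [this]
    exact_mod_cast hpos.ne'
  -- `R σ` is the pairing of `W σ` with `(B(σ) - B(σ₀))w`. The order-four terms cancel, since their
  -- coefficient `κ²` does not depend on `σ`.
  let R : ℝ × ℝ → ℂ := fun σ =>
    -(star (α σ ^ 2 - α σ₀ ^ 2) * J w σ + star (2 * α σ * β σ - 2 * α σ₀ * β σ₀) * J (deriv w) σ +
      star ((2 * α σ * κ + β σ ^ 2) - (2 * α σ₀ * κ + β σ₀ ^ 2)) * J (deriv (deriv w)) σ +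
      star (2 * β σ * κ - 2 * β σ₀ * κ) * J (deriv (deriv (deriv w))) σ)
  -- Symmetry moves `B(σ)` from `W σ` onto `w`, where it differs from `B(σ₀)w = λ(σ₀)w` by the terms
  -- collected in `R`.
  have key : ∀ σ ∈ K, ((lam σ - lam σ₀ : ℝ) : ℂ) * J w σ = R σ := by
    intro σ hσ
    obtain ⟨hv, hvp, hv0, hve⟩ := hW σ hσ
    have cv := hv.continuous
    have hsym := integral_blochOp_mul_conj hu hv hw hvp hwp ε ω b s σ
    have hl : ∫ x in (0 : ℝ)..(2 * Real.pi), blochOp ε ω b s u σ (W σ) x * star (w x) =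
        lam σ * J w σ := by
      simp only [J, hve, mul_assoc, intervalIntegral.integral_const_mul]
    have hr : ∫ x in (0 : ℝ)..(2 * Real.pi), W σ x * star (blochOp ε ω b s u σ w x) =
        lam σ₀ * J w σ + R σ := by
      have e : ∀ x, W σ x * star (blochOp ε ω b s u σ w x) =
          lam σ₀ * (W σ x * star (w x)) +
          (-star (α σ ^ 2 - α σ₀ ^ 2)) * (W σ x * star (w x)) +
          (-star (2 * α σ * β σ - 2 * α σ₀ * β σ₀)) * (W σ x * star (deriv w x)) +
          (-star ((2 * α σ * κ + β σ ^ 2) - (2 * α σ₀ * κ + β σ₀ ^ 2))) *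
            (W σ x * star (deriv (deriv w) x)) +
          (-star (2 * β σ * κ - 2 * β σ₀ * κ)) * (W σ x * star (deriv (deriv (deriv w)) x)) := by
        intro x
        have a1 := blochOp_eq hw ε ω b s u σ (α := α σ) (β := β σ) (κ := κ) rfl rfl rfl x
        have a2 := blochOp_eq hw ε ω b s u σ₀ (α := α σ₀) (β := β σ₀) (κ := κ) rfl rfl rfl x
        rw [hwe x] at a2
        have a3 : blochOp ε ω b s u σ w x = lam σ₀ * w x - ((α σ ^ 2 - α σ₀ ^ 2) * w x +
            (2 * α σ * β σ - 2 * α σ₀ * β σ₀) * deriv w x +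
            ((2 * α σ * κ + β σ ^ 2) - (2 * α σ₀ * κ + β σ₀ ^ 2)) * deriv (deriv w) x +
            (2 * β σ * κ - 2 * β σ₀ * κ) * deriv (deriv (deriv w)) x) := by
          linear_combination a1 - a2
        rw [a3]
        simp only [star_sub, star_add, star_mul', Complex.star_def, Complex.conj_ofReal]
        ring
      simp only [e]
      rw [intervalIntegral.integral_add (Continuous.intervalIntegrable (by fun_prop) _ _)
        (Continuous.intervalIntegrable (by fun_prop) _ _),
        intervalIntegral.integral_add (Continuous.intervalIntegrable (by fun_prop) _ _)
        (Continuous.intervalIntegrable (by fun_prop) _ _),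
        intervalIntegral.integral_add (Continuous.intervalIntegrable (by fun_prop) _ _)
        (Continuous.intervalIntegrable (by fun_prop) _ _),
        intervalIntegral.integral_add (Continuous.intervalIntegrable (by fun_prop) _ _)
        (Continuous.intervalIntegrable (by fun_prop) _ _)]
      simp only [intervalIntegral.integral_const_mul, R, J]
      ring
    rw [hl, hr] at hsym
    push_cast
    linear_combination hsym
  have hO : ∀ (g : ℝ → ℂ) (a : ℝ × ℝ → ℂ), Continuous g → DifferentiableAt ℝ a σ₀ →
      (fun σ => star (a σ - a σ₀) * J g σ) =O[𝓝[K] σ₀] (fun σ => σ - σ₀) := by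
    intro g a hg ha
    have b1 : (fun σ => star (a σ - a σ₀)) =O[𝓝[K] σ₀] (fun σ => σ - σ₀) := by
      refine Asymptotics.IsBigO.congr_left (f₁ := fun σ => star (a σ - a σ₀)) ?_ fun _ => rfl
      rw [← Asymptotics.isBigO_norm_left]
      simp only [norm_star]
      rw [Asymptotics.isBigO_norm_left]
      exact ha.isBigO_sub.mono nhdsWithin_le_nhds
    have b2 : (J g) =O[𝓝[K] σ₀] (fun _ => (1 : ℝ)) := (hJ g hg).tendsto.isBigO_one ℝ
    rw [← Asymptotics.isBigO_norm_right]
    simpa using b1.norm_right.mul b2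
  have dα : DifferentiableAt ℝ α σ₀ := by
    simp only [α]
    have e1 : DifferentiableAt ℝ (fun σ : ℝ × ℝ => (σ.1 : ℂ)) σ₀ :=
      (Complex.ofRealCLM.comp (ContinuousLinearMap.fst ℝ ℝ ℝ)).differentiableAt
    have e2 : DifferentiableAt ℝ (fun σ : ℝ × ℝ => (σ.2 : ℂ)) σ₀ :=
      (Complex.ofRealCLM.comp (ContinuousLinearMap.snd ℝ ℝ ℝ)).differentiableAt
    fun_prop
  have dβ : DifferentiableAt ℝ β σ₀ := by
    simp only [β]
    have e1 : DifferentiableAt ℝ (fun σ : ℝ × ℝ => (σ.1 : ℂ)) σ₀ :=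
      (Complex.ofRealCLM.comp (ContinuousLinearMap.fst ℝ ℝ ℝ)).differentiableAt
    fun_prop
  have hR : R =O[𝓝[K] σ₀] (fun σ => σ - σ₀) := by
    refine Asymptotics.IsBigO.neg_left (Asymptotics.IsBigO.add (Asymptotics.IsBigO.add
      (Asymptotics.IsBigO.add ?_ ?_) ?_) ?_)
    · exact hO w (fun σ => α σ ^ 2) c0 (by fun_prop)
    · exact hO _ (fun σ => 2 * α σ * β σ) c1 (by fun_prop)
    · exact hO _ (fun σ => 2 * α σ * κ + β σ ^ 2) c2 (by fun_prop)
    · exact hO _ (fun σ => 2 * β σ * κ) c3 (by fun_prop)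
  -- Division by the pairing is legitimate near `σ₀`, because at `σ₀` it equals `∫ |w|² ≠ 0`.
  have hinv : (fun σ => (J w σ)⁻¹) =O[𝓝[K] σ₀] (fun _ => (1 : ℝ)) :=
    ((hJ w c0).tendsto.inv₀ hJ0).isBigO_one ℝ
  have hlam : (fun σ => R σ * (J w σ)⁻¹) =O[𝓝[K] σ₀] (fun σ => σ - σ₀) := by
    rw [← Asymptotics.isBigO_norm_right]
    simpa using hR.norm_right.mul hinv
  rw [← Asymptotics.isBigO_norm_left] at hlam ⊢
  refine hlam.congr' ?_ EventuallyEq.rfl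
  filter_upwards [self_mem_nhdsWithin, (hJ w c0).tendsto.eventually_ne hJ0] with σ hσ hne
  rw [← key σ hσ, mul_assoc, mul_inv_cancel₀ hne, mul_one, Complex.norm_real]

/-! ### The prefactor -/

theorem isCompact_square (σbar : ℝ × ℝ) (c : ℝ) : IsCompact (square σbar c) :=
  isCompact_Icc.prod isCompact_Icc

theorem measurableSet_square (σbar : ℝ × ℝ) (c : ℝ) : MeasurableSet (square σbar c) :=
  measurableSet_Icc.prod measurableSet_Icc

theorem mem_square_self (σbar : ℝ × ℝ) {c : ℝ} (hc : 0 ≤ c) : σbar ∈ square σbar c :=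
  ⟨⟨le_rfl, by linarith⟩, ⟨le_rfl, by linarith⟩⟩

theorem square_subset (σbar : ℝ × ℝ) {r c : ℝ} (h : r ≤ c) : square σbar r ⊆ square σbar c :=
  Set.prod_mono (Set.Icc_subset_Icc_right (by linarith)) (Set.Icc_subset_Icc_right (by linarith))

theorem norm_sub_le_of_mem_square {σbar σ : ℝ × ℝ} {r : ℝ} (h : σ ∈ square σbar r) :
    ‖σ - σbar‖ ≤ r := by
  obtain ⟨⟨h1, h2⟩, ⟨h3, h4⟩⟩ := h
  rw [Prod.norm_def, Prod.fst_sub, Prod.snd_sub, Real.norm_eq_abs, Real.norm_eq_abs]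
  exact max_le (abs_le.2 ⟨by linarith, by linarith⟩) (abs_le.2 ⟨by linarith, by linarith⟩)

theorem volume_real_square (σbar : ℝ × ℝ) {c : ℝ} (hc : 0 ≤ c) :
    (volume : Measure (ℝ × ℝ)).real (square σbar c) = c ^ 2 := by
  rw [Measure.real, square, Measure.volume_eq_prod, Measure.prod_prod, Real.volume_Icc,
    Real.volume_Icc, ENNReal.toReal_mul, add_sub_cancel_left, add_sub_cancel_left,
    ENNReal.toReal_ofReal hc, sq]

theorem integrableOn_exp_eigenvalue {lam : ℝ × ℝ → ℝ} {σbar : ℝ × ℝ} {c : ℝ}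
    (hl : ContinuousOn lam (square σbar c)) (t : ℝ) :
    IntegrableOn (fun σ => Real.exp (2 * (lam σ - lam σbar) * t)) (square σbar c) :=
  ContinuousOn.integrableOn_compact (isCompact_square σbar c) (by fun_prop)

theorem prefactor_le {lam : ℝ × ℝ → ℝ} {σbar : ℝ × ℝ} {c : ℝ} (hc : 0 ≤ c)
    (hl : ContinuousOn lam (square σbar c)) (hmax : ∀ σ ∈ square σbar c, lam σ ≤ lam σbar)
    {t : ℝ} (ht : 0 ≤ t) : prefactor lam σbar c t ≤ c := by
  have hfin : volume (square σbar c) ≠ ⊤ := (isCompact_square σbar c).measure_lt_top.ne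
  refine Real.sqrt_le_iff.2 ⟨hc, ?_⟩
  calc _ ≤ ∫ _ in square σbar c, (1 : ℝ) := by
        refine setIntegral_mono_on (integrableOn_exp_eigenvalue hl t)
          (integrableOn_const hfin) (measurableSet_square σbar c) fun σ hσ => ?_
        rw [Real.exp_le_one_iff]
        nlinarith [hmax σ hσ]
    _ = c ^ 2 := by
        rw [setIntegral_const, volume_real_square σbar hc, smul_eq_mul, mul_one]

/-- On a square of side `r` of order `(1 + t)^{-1/l}` the exponent `2(λ(σ) - λ(σ̄))t` is bounded
below uniformly in `t`. The integral is then at least a constant times the area `r²`, and its root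
is linear in `r`. -/
theorem exists_prefactor_ge {lam : ℝ × ℝ → ℝ} {σbar : ℝ × ℝ} {c : ℝ} (hc : 0 < c)
    (hl : ContinuousOn lam (square σbar c)) {l : ℕ} (hl0 : 0 < l)
    (hO : (fun σ => lam σ - lam σbar) =O[𝓝[square σbar c] σbar] (fun σ => ‖σ - σbar‖ ^ l)) :
    ∃ C₁ : ℝ, 0 < C₁ ∧ ∀ t, 0 ≤ t → C₁ / (1 + t) ^ (1 / (l : ℝ)) ≤ prefactor lam σbar c t := by
  obtain ⟨C, hC0, hC⟩ := hO.exists_pos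
  rw [Asymptotics.isBigOWith_iff, eventually_nhdsWithin_iff, Metric.eventually_nhds_iff] at hC
  obtain ⟨δ₀, hδ₀, hδ⟩ := hC
  -- `δ < δ₀` puts the closed square of side `δ` inside the open ball where the `O`-bound holds; `δ
  -- ≤ c` keeps it in the domain of integration.
  obtain ⟨δ, hδ0, hδ1, hδ2⟩ : ∃ δ, 0 < δ ∧ δ < δ₀ ∧ δ ≤ c :=
    ⟨min (δ₀ / 2) c, by positivity, (min_le_left _ _).trans_lt (by linarith), min_le_right _ _⟩
  refine ⟨Real.exp (-(C * δ ^ l)) * δ, by positivity, fun t ht => ?_⟩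
  set q := (1 + t) ^ (1 / (l : ℝ)) with hq
  have hq1 : 1 ≤ q := Real.one_le_rpow (by linarith) (by positivity)
  have hq0 : 0 < q := by linarith
  have hql : q ^ l = 1 + t := by
    rw [hq, ← Real.rpow_natCast, ← Real.rpow_mul (by linarith), one_div,
      inv_mul_cancel₀ (by positivity), Real.rpow_one]
  -- This choice makes `r ^ l * t = δ ^ l * t / (1 + t) ≤ δ ^ l`.
  set r := δ / q with hr
  have hr0 : 0 < r := by positivity
  have hrδ : r ≤ δ := div_le_self hδ0.le hq1
  have hrt : r ^ l * t ≤ δ ^ l := by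
    rw [hr, div_pow, hql, div_mul_eq_mul_div, div_le_iff₀ (by linarith)]
    have : 0 < δ ^ l := by positivity
    nlinarith
  have hsub : square σbar r ⊆ square σbar c := square_subset σbar (hrδ.trans hδ2)
  have hfin : volume (square σbar r) ≠ ⊤ := (isCompact_square σbar r).measure_lt_top.ne
  have hint := integrableOn_exp_eigenvalue hl t
  have hlow : (Real.exp (-(C * δ ^ l)) * r) ^ 2 ≤
      ∫ σ in square σbar c, Real.exp (2 * (lam σ - lam σbar) * t) := by
    calc _ = ∫ _ in square σbar r, Real.exp (-(C * δ ^ l)) ^ 2 := by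
          rw [setIntegral_const, volume_real_square σbar hr0.le, smul_eq_mul]
          ring
      _ ≤ ∫ σ in square σbar r, Real.exp (2 * (lam σ - lam σbar) * t) := by
          refine setIntegral_mono_on (integrableOn_const hfin) (hint.mono_set hsub)
            (measurableSet_square σbar r) fun σ hσ => ?_
          have hn := norm_sub_le_of_mem_square hσ
          have hb := hδ (y := σ) (by rw [dist_eq_norm]; linarith) (hsub hσ)
          rw [Real.norm_eq_abs, norm_pow, norm_norm] at hb
          have hb2 : |lam σ - lam σbar| ≤ C * r ^ l := hb.trans (by gcongr)
          have hb3 := (abs_le.1 hb2).1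
          rw [← Real.exp_nat_mul, Real.exp_le_exp]
          push_cast
          nlinarith [mul_le_mul_of_nonneg_right hb3 ht, mul_le_mul_of_nonneg_left hrt hC0.le]
      _ ≤ _ := setIntegral_mono_set hint (Eventually.of_forall fun σ => (Real.exp_pos _).le)
          (LE.le.eventuallyLE hsub)
  calc _ = Real.exp (-(C * δ ^ l)) * r := by rw [hr]; ring
    _ ≤ _ := Real.le_sqrt_of_sq_le hlow

/-! ### The linearized operator in Fourier variables -/

/-- The Fourier symbol of `1 + (1 + 2εω)∂ₓ² + ∂_y²`. -/
def planeSymbol (ε ω : ℝ) (ξ : Plane) : ℝ :=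
  1 - (1 + 2 * ε * ω) * (2 * Real.pi * ξ 0) ^ 2 - (2 * Real.pi * ξ 1) ^ 2

theorem hasTemperateGrowth_coord (i : Fin 2) :
    (fun ξ : Plane => ((ξ i : ℝ) : ℂ)).HasTemperateGrowth :=
  (Complex.ofRealCLM.comp (EuclideanSpace.proj (𝕜 := ℝ) i)).hasTemperateGrowth

theorem hasTemperateGrowth_planeSymbol (ε ω : ℝ) :
    (fun ξ : Plane => (planeSymbol ε ω ξ : ℂ)).HasTemperateGrowth := by
  have h0 := hasTemperateGrowth_coord 0
  have h1 := hasTemperateGrowth_coord 1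
  simp only [planeSymbol]
  push_cast
  fun_prop

theorem inner_single_one (i : Fin 2) (ξ : Plane) :
    inner ℝ ξ (EuclideanSpace.single i 1 : Plane) = ξ i := by
  simp [EuclideanSpace.inner_single_right]

theorem fourier_lineDeriv_lineDeriv (i : Fin 2) (T : 𝓢'(Plane, ℂ)) :
    𝓕 (∂_{(EuclideanSpace.single i 1 : Plane)} (∂_{(EuclideanSpace.single i 1 : Plane)} T)) =
      smulLeftCLM ℂ (fun ξ : Plane => -(2 * Real.pi * (ξ i : ℂ)) ^ 2) (𝓕 T) := by
  have h0 := hasTemperateGrowth_coord i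
  rw [TemperedDistribution.fourier_lineDerivOp_eq, TemperedDistribution.fourier_lineDerivOp_eq]
  simp only [inner_single_one]
  rw [map_smul, smulLeftCLM_smulLeftCLM_apply h0 h0, smul_smul, ← smul_apply,
    ← smulLeftCLM_smul (by exact h0.mul h0)]
  congr 2
  funext ξ
  simp only [Pi.smul_apply, Pi.mul_apply, smul_eq_mul]
  linear_combination (4 * (Real.pi : ℂ) ^ 2 * (ξ i : ℂ) ^ 2) * Complex.I_sq

theorem fourier_planeOp (ε ω : ℝ) (T : 𝓢'(Plane, ℂ)) :
    𝓕 (planeOp ε ω T) = smulLeftCLM ℂ (fun ξ : Plane => (planeSymbol ε ω ξ : ℂ)) (𝓕 T) := by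
  have h0 := hasTemperateGrowth_coord 0
  have h1 := hasTemperateGrowth_coord 1
  have g0 : (fun ξ : Plane => -(2 * Real.pi * (ξ 0 : ℂ)) ^ 2).HasTemperateGrowth := by fun_prop
  have g1 : (fun ξ : Plane => -(2 * Real.pi * (ξ 1 : ℂ)) ^ 2).HasTemperateGrowth := by fun_prop
  have gc : (fun _ : Plane => (1 : ℂ)).HasTemperateGrowth := by fun_prop
  have e : (fun ξ : Plane => (planeSymbol ε ω ξ : ℂ)) =
      ((fun _ : Plane => (1 : ℂ)) + ((1 + 2 * ε * ω : ℝ) : ℂ) •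
        (fun ξ : Plane => -(2 * Real.pi * (ξ 0 : ℂ)) ^ 2)) +
        (fun ξ : Plane => -(2 * Real.pi * (ξ 1 : ℂ)) ^ 2) := by
    funext ξ
    simp only [planeSymbol, Pi.add_apply, Pi.smul_apply, smul_eq_mul]
    push_cast
    ring
  have gk : (((1 + 2 * ε * ω : ℝ) : ℂ) •
        (fun ξ : Plane => -(2 * Real.pi * (ξ 0 : ℂ)) ^ 2)).HasTemperateGrowth := by
    change (fun ξ : Plane => ((1 + 2 * ε * ω : ℝ) : ℂ) •
        (-(2 * Real.pi * (ξ 0 : ℂ)) ^ 2)).HasTemperateGrowth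
    fun_prop
  rw [planeOp, FourierTransform.fourier_add, FourierTransform.fourier_add,
    FourierTransform.fourier_smul, fourier_lineDeriv_lineDeriv, fourier_lineDeriv_lineDeriv, e,
    smulLeftCLM_add (gc.add gk) g1, smulLeftCLM_add gc gk, smulLeftCLM_smul g0]
  simp only [add_apply, smul_apply, smulLeftCLM_const,
    one_smul]

/-- The product `g * b` need not be in `L²`, but it is locally integrable, so testing against
compactly supported smooth functions identifies it with `a` almost everywhere. -/
theorem ae_eq_of_toTemperedDistribution_eq_smulLeftCLM {g : Plane → ℂ} (hg : g.HasTemperateGrowth)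
    {a b : L2Plane} (h : (a : 𝓢'(Plane, ℂ)) = smulLeftCLM ℂ g (b : 𝓢'(Plane, ℂ))) :
    ∀ᵐ ξ : Plane, a ξ = g ξ * b ξ := by
  have ha : LocallyIntegrable a (volume : Measure Plane) :=
    (Lp.memLp a).locallyIntegrable (by norm_num)
  have hb : LocallyIntegrable b (volume : Measure Plane) :=
    (Lp.memLp b).locallyIntegrable (by norm_num)
  refine ae_eq_of_integral_contDiff_smul_eq ha ?_ ?_
  · rw [← locallyIntegrableOn_univ] at hb ⊢
    exact hb.continuousOn_mul hg.1.continuous.continuousOn isOpen_univ.isLocallyClosed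
  · intro φ hφ hφc
    have h₁ : HasCompactSupport (Complex.ofRealCLM ∘ φ) := hφc.comp_left rfl
    have h₂ : ContDiff ℝ ((⊤ : ℕ∞) : WithTop ℕ∞) (Complex.ofRealCLM ∘ φ) := by fun_prop
    have h' := DFunLike.congr_fun h (h₁.toSchwartzMap h₂)
    rw [smulLeftCLM_apply_apply, Lp.toTemperedDistribution_apply,
      Lp.toTemperedDistribution_apply] at h'
    simpa [SchwartzMap.smulLeftCLM_apply_apply hg, mul_assoc, mul_left_comm] using h'

theorem fourier_ae_eq_of_eq_planeOp_planeOp {ε ω : ℝ} {v h : L2Plane}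
    (hv : (h : 𝓢'(Plane, ℂ)) = planeOp ε ω (planeOp ε ω (v : 𝓢'(Plane, ℂ)))) :
    ∀ᵐ ξ : Plane, (𝓕 h : L2Plane) ξ = (planeSymbol ε ω ξ : ℂ) ^ 2 * (𝓕 v : L2Plane) ξ := by
  have hs := hasTemperateGrowth_planeSymbol ε ω
  have h1 := congrArg (fun T : 𝓢'(Plane, ℂ) => 𝓕 T) hv
  simp only [fourier_planeOp, Lp.fourier_toTemperedDistribution_eq,
    smulLeftCLM_smulLeftCLM_apply hs hs] at h1
  filter_upwards [ae_eq_of_toTemperedDistribution_eq_smulLeftCLM (by exact hs.mul hs) h1] with ξ hξ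
  rw [hξ, Pi.mul_apply, sq]

/-- Ellipticity, which rests on `1 + 2εω > 0`. With `m` the symbol, `κ(1 + |ξ|²) ≤ 2 + |m|`, and `(2
+ |m|)² ≤ 8 + 2m²` explains the constant `8 / κ²`. -/
theorem exists_weight_le_planeSymbol {ε ω : ℝ} (hk : 0 < 1 + 2 * ε * ω) :
    ∃ C, 0 ≤ C ∧ ∀ ξ : Plane, (1 + ‖ξ‖ ^ 2) ^ 2 ≤ C * (1 + planeSymbol ε ω ξ ^ 2) := by
  set κ := min (1 + 2 * ε * ω) 1 with hκ
  have hκ0 : 0 < κ := lt_min hk one_pos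
  have hκ1 : κ ≤ 1 := min_le_right _ _
  have hκk : κ ≤ 1 + 2 * ε * ω := min_le_left _ _
  refine ⟨8 / κ ^ 2, by positivity, fun ξ => ?_⟩
  have hn : ‖ξ‖ ^ 2 = ξ 0 ^ 2 + ξ 1 ^ 2 := by
    rw [EuclideanSpace.norm_sq_eq, Fin.sum_univ_two, Real.norm_eq_abs, Real.norm_eq_abs, sq_abs,
      sq_abs]
  have hpi : 1 ≤ (2 * Real.pi) ^ 2 := by nlinarith [Real.pi_gt_three]
  set X := ξ 0 ^ 2
  set Y := ξ 1 ^ 2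
  have hX : 0 ≤ X := sq_nonneg _
  have hY : 0 ≤ Y := sq_nonneg _
  set m := planeSymbol ε ω ξ with hm
  have hm1 : m = 1 - (1 + 2 * ε * ω) * ((2 * Real.pi) ^ 2 * X) - (2 * Real.pi) ^ 2 * Y := by
    rw [hm, planeSymbol]; ring
  have h1 : κ * (X + Y) ≤ 1 - m := by
    have a1 : X ≤ (2 * Real.pi) ^ 2 * X := le_mul_of_one_le_left hX hpi
    have a2 : Y ≤ (2 * Real.pi) ^ 2 * Y := le_mul_of_one_le_left hY hpi
    have a3 : κ * X ≤ (1 + 2 * ε * ω) * ((2 * Real.pi) ^ 2 * X) :=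
      mul_le_mul hκk a1 hX hk.le
    have a4 : κ * Y ≤ 1 * ((2 * Real.pi) ^ 2 * Y) := mul_le_mul hκ1 a2 hY zero_le_one
    linarith
  rw [hn, div_mul_eq_mul_div, le_div_iff₀ (by positivity)]
  have h2 : κ * (1 + (X + Y)) ≤ 2 + |m| := by
    nlinarith [neg_abs_le m]
  have h3 : (κ * (1 + (X + Y))) ^ 2 ≤ (2 + |m|) ^ 2 := by gcongr
  nlinarith [sq_abs m, sq_nonneg (|m| - 2), abs_nonneg m, sq_nonneg (|m| - 1)]

/-- Elliptic regularity: `v̂` and `m² v̂` are both in `L²`, and `1 + m²` dominates `(1 + |ξ|²)²` up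
to a constant. -/
theorem memSobolev_four_of_eq_planeOp_planeOp {ε ω : ℝ} (hk : 0 < 1 + 2 * ε * ω) {v h : L2Plane}
    (hv : (h : 𝓢'(Plane, ℂ)) = planeOp ε ω (planeOp ε ω (v : 𝓢'(Plane, ℂ)))) :
    MemSobolev 4 2 (v : 𝓢'(Plane, ℂ)) := by
  obtain ⟨C, hC0, hC⟩ := exists_weight_le_planeSymbol hk
  have hae := fourier_ae_eq_of_eq_planeOp_planeOp hv
  have hw : (fun ξ : Plane => (((1 + ‖ξ‖ ^ 2) ^ ((4 : ℝ) / 2) : ℝ) : ℂ)).HasTemperateGrowth := by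
    fun_prop
  rw [memSobolev_iff_exists_smulLeftCLM_fourier, Lp.fourier_toTemperedDistribution_eq]
  have hmem : MemLp (fun ξ : Plane => (((1 + ‖ξ‖ ^ 2) ^ ((4 : ℝ) / 2) : ℝ) : ℂ) *
      (𝓕 v : L2Plane) ξ) 2 volume := by
    refine MemLp.of_le_mul (c := C) ((Lp.memLp (𝓕 v : L2Plane)).norm.add
      (Lp.memLp (𝓕 h : L2Plane)).norm) ?_ ?_
    · exact hw.1.continuous.aestronglyMeasurable.mul (Lp.aestronglyMeasurable _)
    · filter_upwards [hae] with ξ hξ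
      have h1 : (1 + ‖ξ‖ ^ 2) ^ ((4 : ℝ) / 2) = (1 + ‖ξ‖ ^ 2) ^ 2 := by
        rw [← Real.rpow_natCast]; norm_num
      simp only [Pi.add_apply]
      rw [norm_mul, Complex.norm_real, h1, hξ, norm_mul, norm_pow (planeSymbol ε ω ξ : ℂ),
        Complex.norm_real, Real.norm_of_nonneg (by positivity), Real.norm_of_nonneg (by positivity),
        Real.norm_eq_abs, sq_abs]
      nlinarith [mul_le_mul_of_nonneg_right (hC ξ) (norm_nonneg ((𝓕 v : L2Plane) ξ))]
  refine ⟨hmem.toLp, ?_⟩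
  ext φ
  rw [smulLeftCLM_apply_apply, Lp.toTemperedDistribution_apply, Lp.toTemperedDistribution_apply]
  refine integral_congr_ae ?_
  filter_upwards [hmem.coeFn_toLp] with ξ hξ
  rw [hξ, SchwartzMap.smulLeftCLM_apply_apply hw]
  simp only [smul_eq_mul]
  ring

/-! ### Energy estimate and uniqueness of the orbit -/

/-- The fourth-order part has the real symbol `-m² ≤ 0`, so by Plancherel only the bounded potential
can contribute to growth. -/
theorem re_inner_le_of_linearizedOp {ε ω b s M : ℝ} {u : ℝ → ℝ}
    (hM : ∀ x, |potential ε b s u x| ≤ M) {v f : L2Plane} (h : LinearizedOp ε ω b s u v f) :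
    (inner ℂ v f).re ≤ M * ‖v‖ ^ 2 := by
  obtain ⟨-, g, hg, hf⟩ := h
  have hh : ((g - f : L2Plane) : 𝓢'(Plane, ℂ)) =
      planeOp ε ω (planeOp ε ω (v : 𝓢'(Plane, ℂ))) := by
    have : ((g - f : L2Plane) : 𝓢'(Plane, ℂ)) = (g : 𝓢'(Plane, ℂ)) - (f : 𝓢'(Plane, ℂ)) :=
      map_sub (Lp.toTemperedDistributionCLM ℂ (volume : Measure Plane) 2) g f
    rw [this, hf]
    abel
  have hae := fourier_ae_eq_of_eq_planeOp_planeOp hh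
  have h1 : 0 ≤ (inner ℂ v (g - f)).re := by
    rw [← Lp.inner_fourier_eq, L2.inner_def]
    have e : ∫ ξ : Plane, inner ℂ ((𝓕 v : L2Plane) ξ) ((𝓕 (g - f) : L2Plane) ξ) =
        ((∫ ξ : Plane, planeSymbol ε ω ξ ^ 2 * ‖(𝓕 v : L2Plane) ξ‖ ^ 2 : ℝ) : ℂ) := by
      rw [← integral_complex_ofReal]
      refine integral_congr_ae ?_
      filter_upwards [hae] with ξ hξ
      rw [hξ, RCLike.inner_apply, mul_assoc, Complex.mul_conj, Complex.normSq_eq_norm_sq]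
      push_cast
      ring
    rw [e, Complex.ofReal_re]
    exact integral_nonneg fun ξ => by positivity
  have h2 : ‖g‖ ≤ M * ‖v‖ := by
    refine Lp.norm_le_mul_norm_of_ae_le_mul ?_
    filter_upwards [hg] with p hp
    rw [hp, norm_mul, Complex.norm_real]
    gcongr
    exact hM _
  have h3 : (inner ℂ v g).re ≤ ‖v‖ * ‖g‖ := re_inner_le_norm (𝕜 := ℂ) v g
  rw [inner_sub_right, Complex.sub_re] at h1
  nlinarith [norm_nonneg v]

theorem LinearizedOp.sub {ε ω b s : ℝ} {u : ℝ → ℝ} {v₁ v₂ f₁ f₂ : L2Plane}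
    (h₁ : LinearizedOp ε ω b s u v₁ f₁) (h₂ : LinearizedOp ε ω b s u v₂ f₂) :
    LinearizedOp ε ω b s u (v₁ - v₂) (f₁ - f₂) := by
  obtain ⟨m₁, g₁, hg₁, e₁⟩ := h₁
  obtain ⟨m₂, g₂, hg₂, e₂⟩ := h₂
  have hsub : ∀ a b : L2Plane, ((a - b : L2Plane) : 𝓢'(Plane, ℂ)) =
      (a : 𝓢'(Plane, ℂ)) - (b : 𝓢'(Plane, ℂ)) :=
    fun a b => map_sub (Lp.toTemperedDistributionCLM ℂ (volume : Measure Plane) 2) a b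
  have hop : ∀ S T : 𝓢'(Plane, ℂ), planeOp ε ω (S - T) = planeOp ε ω S - planeOp ε ω T := by
    intro S T
    have hl : ∀ (m : Plane) (S T : 𝓢'(Plane, ℂ)), ∂_{m} (S - T) = ∂_{m} S - ∂_{m} T :=
      fun m S T => map_sub (LineDeriv.lineDerivOpCLM ℂ 𝓢'(Plane, ℂ) m) S T
    simp only [planeOp, hl, smul_sub]
    abel
  refine ⟨by rw [hsub]; exact m₁.sub m₂, g₁ - g₂, ?_, ?_⟩
  · filter_upwards [hg₁, hg₂, Lp.coeFn_sub g₁ g₂, Lp.coeFn_sub v₁ v₂] with p a1 a2 a3 a4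
    rw [a3, a4, Pi.sub_apply, Pi.sub_apply, a1, a2, mul_sub]
  · rw [hsub, hsub, hsub, hop, hop, e₁, e₂]
    abel

/-- For the difference `d` of two orbits, `e^{-2Mt}‖d(t)‖²` has nonpositive derivative for `t > 0`,
is continuous on `[0, ∞)`, and vanishes at `0`. The equation is not needed at `t = 0`. -/
theorem IsSemigroupOrbit.eq_of_linearizedOp {ε ω b s M : ℝ} {u : ℝ → ℝ}
    (hM : ∀ x, |potential ε b s u x| ≤ M) {w : L2Plane} {V V' : ℝ → L2Plane}
    (hV : IsSemigroupOrbit (LinearizedOp ε ω b s u) w V)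
    (hV' : IsSemigroupOrbit (LinearizedOp ε ω b s u) w V') {t : ℝ} (ht : 0 ≤ t) :
    V' t = V t := by
  obtain ⟨h0, hc, hd⟩ := hV
  obtain ⟨h0', hc', hd'⟩ := hV'
  let d : ℝ → L2Plane := fun t => V' t - V t
  let F : ℝ → ℝ := fun t => Real.exp (-(2 * M) * t) * ‖d t‖ ^ 2
  have hdc : ContinuousOn d (Set.Ici 0) := hc'.sub hc
  have hFd : ∀ t, 0 < t → ∃ F', HasDerivAt F F' t ∧ F' ≤ 0 := by
    intro t ht
    obtain ⟨f, hf, hf'⟩ := hd t ht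
    obtain ⟨g, hg, hg'⟩ := hd' t ht
    have hdd : HasDerivAt d (g - f) t := hg'.sub hf'
    have hdis := re_inner_le_of_linearizedOp hM (hg.sub hf)
    have h1 := hdd.inner ℂ hdd
    have h2 := Complex.reCLM.hasFDerivAt.comp_hasDerivAt t h1
    have h3 : HasDerivAt (fun t => ‖d t‖ ^ 2) (2 * (inner ℂ (d t) (g - f)).re) t := by
      have e1 : (fun t => ‖d t‖ ^ 2) = Complex.reCLM ∘ fun t => inner ℂ (d t) (d t) := by
        funext τ
        simp [inner_self_eq_norm_sq_to_K, ← Complex.ofReal_pow]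
      have e2 : 2 * (inner ℂ (d t) (g - f)).re =
          Complex.reCLM (inner ℂ (d t) (g - f) + inner ℂ (g - f) (d t)) := by
        have h4 : (inner ℂ (g - f) (d t)).re = (inner ℂ (d t) (g - f)).re :=
          inner_re_symm (𝕜 := ℂ) _ _
        rw [Complex.reCLM_apply, Complex.add_re, h4]
        ring
      rw [e1, e2]
      exact h2
    have h5 : HasDerivAt (fun t : ℝ => Real.exp (-(2 * M) * t))
        (Real.exp (-(2 * M) * t) * (-(2 * M))) t := by
      simpa using ((hasDerivAt_id t).const_mul (-(2 * M))).exp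
    refine ⟨_, h5.mul h3, ?_⟩
    have h6 := Real.exp_pos (-(2 * M) * t)
    have h7 : (inner ℂ (d t) (g - f)).re ≤ M * ‖d t‖ ^ 2 := hdis
    nlinarith
  have hFc : ContinuousOn F (Set.Ici 0) := by
    refine ContinuousOn.mul (by fun_prop) (hdc.norm.pow 2)
  have hanti : AntitoneOn F (Set.Ici 0) := by
    refine antitoneOn_of_deriv_nonpos (convex_Ici 0) hFc ?_ ?_
    · intro t ht
      rw [interior_Ici] at ht
      obtain ⟨_, h, _⟩ := hFd t ht
      exact h.differentiableAt.differentiableWithinAt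
    · intro t ht
      rw [interior_Ici] at ht
      obtain ⟨_, h, h'⟩ := hFd t ht
      rwa [h.deriv]
  have h := hanti (Set.mem_Ici.2 le_rfl) (Set.mem_Ici.2 ht) ht
  have hF0 : F 0 = 0 := by simp [F, d, h0, h0']
  rw [hF0] at h
  have h8 : ‖d t‖ ^ 2 ≤ 0 := by
    by_contra hne
    push Not at hne
    have := mul_pos (Real.exp_pos (-(2 * M) * t)) hne
    exact absurd h (not_le.2 this)
  have h9 : ‖d t‖ = 0 := by nlinarith [norm_nonneg (d t)]
  exact sub_eq_zero.1 (norm_eq_zero.1 h9)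

/-! ### Bloch coordinates on the frequency plane -/

/-- Fubini with a symmetric kernel; the inverse transform is the Fourier integral for the bilinear
form `-⟨·, ·⟩`. -/
theorem integral_fourierInv_smul_eq_of_integrable {f g : Plane → ℂ} (hf : Integrable f)
    (hg : Integrable g) : ∫ ξ, 𝓕⁻ f ξ * g ξ = ∫ x, f x * 𝓕⁻ g x := by
  have h := VectorFourier.integral_fourierIntegral_smul_eq_flip (L := -innerₗ Plane)
    Real.continuous_fourierChar (continuous_inner (𝕜 := ℝ) (E := Plane)).neg hf hg
  have hflip : (-innerₗ Plane).flip = -innerₗ Plane := by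
    ext x y
    simp [real_inner_comm]
  rw [hflip] at h
  simpa using! h

theorem continuous_fourierInv_of_integrable {f : Plane → ℂ} (hf : Integrable f) :
    Continuous (𝓕⁻ f) :=
  VectorFourier.fourierIntegral_continuous (L := -innerₗ Plane) Real.continuous_fourierChar
    (continuous_inner (𝕜 := ℝ) (E := Plane)).neg hf

/-- The inverse Fourier transform on `L²` is given by the integral on `L¹ ∩ L²`. -/
theorem fourierInv_toLp_ae_eq {G : Plane → ℂ} (h1 : Integrable G) (h2 : MemLp G 2 volume) :
    ∀ᵐ p : Plane, (𝓕⁻ h2.toLp : L2Plane) p = 𝓕⁻ G p := by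
  -- Both sides are tested against `φ`: as distributions, `𝓕⁻` passes from `G` to `φ`, and Fubini
  -- brings it back to `G` as an integral.
  refine ae_eq_of_integral_contDiff_smul_eq ((Lp.memLp _).locallyIntegrable (by norm_num))
    (continuous_fourierInv_of_integrable h1).locallyIntegrable ?_
  intro φ hφ hφc
  have hc₁ : HasCompactSupport (Complex.ofRealCLM ∘ φ) := hφc.comp_left rfl
  have hc₂ : ContDiff ℝ ((⊤ : ℕ∞) : WithTop ℕ∞) (Complex.ofRealCLM ∘ φ) := by fun_prop
  have h := DFunLike.congr_fun (Lp.fourierInv_toTemperedDistribution_eq h2.toLp)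
    (hc₁.toSchwartzMap hc₂)
  rw [TemperedDistribution.fourierInv_apply, Lp.toTemperedDistribution_apply,
    Lp.toTemperedDistribution_apply] at h
  have h3 : ∫ ξ, (𝓕⁻ (hc₁.toSchwartzMap hc₂) : 𝓢(Plane, ℂ)) ξ * G ξ =
      ∫ x, (hc₁.toSchwartzMap hc₂) x * 𝓕⁻ G x := by
    rw [SchwartzMap.fourierInv_coe]
    exact integral_fourierInv_smul_eq_of_integrable (SchwartzMap.integrable _) h1
  have h4 : ∫ ξ, (𝓕⁻ (hc₁.toSchwartzMap hc₂) : 𝓢(Plane, ℂ)) ξ • (h2.toLp : L2Plane) ξ =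
      ∫ ξ, (𝓕⁻ (hc₁.toSchwartzMap hc₂) : 𝓢(Plane, ℂ)) ξ * G ξ := by
    refine integral_congr_ae ?_
    filter_upwards [h2.coeFn_toLp] with ξ hξ
    rw [hξ, smul_eq_mul]
  rw [h4, h3] at h
  simpa using h.symm

/-- `x = j + s` with `j ∈ ℤ` and `s ∈ [a, a + 1)`. -/
def foldReal (a x : ℝ) : ℤ × ℝ := (⌊x - a⌋, a + Int.fract (x - a))

/-- The preimage of `s ×ˢ t` is the disjoint union over `j ∈ s` of the translates by `j` of `t ∩ [a,
a + 1)`. The closed interval differs from the half-open one by a null set and can contain the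
compact square. -/
theorem measurePreserving_foldReal (a : ℝ) :
    MeasurePreserving (foldReal a) volume
      (Measure.count.prod (volume.restrict (Set.Icc a (a + 1)))) := by
  have hm : Measurable (foldReal a) := by
    unfold foldReal
    exact (Int.measurable_floor.comp (by fun_prop)).prodMk
      ((measurable_fract.comp (by fun_prop)).const_add a)
  refine ⟨hm, (Measure.prod_eq fun s t hs ht => ?_).symm⟩
  rw [Measure.map_apply hm (hs.prod ht), ← restrict_Ico_eq_restrict_Icc, Measure.restrict_apply ht]
  have hset : foldReal a ⁻¹' (s ×ˢ t) =
      ⋃ j ∈ s, (fun x => x - (j : ℝ)) ⁻¹' (t ∩ Set.Ico a (a + 1)) := by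
    ext x
    simp only [foldReal, Set.mem_preimage, Set.mem_prod, Set.mem_iUnion, Set.mem_inter_iff,
      Set.mem_Ico, exists_prop]
    constructor
    · rintro ⟨h1, h2⟩
      have e : x - (⌊x - a⌋ : ℝ) = a + Int.fract (x - a) := by
        rw [← Int.self_sub_floor]; ring
      refine ⟨_, h1, by rwa [e], ?_⟩
      rw [e]
      exact ⟨by linarith [Int.fract_nonneg (x - a)], by linarith [Int.fract_lt_one (x - a)]⟩
    · rintro ⟨j, hj, h1, h2, h3⟩
      have e : ⌊x - a⌋ = j := Int.floor_eq_iff.2 ⟨by linarith, by linarith⟩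
      have e' : a + Int.fract (x - a) = x - j := by
        rw [← Int.self_sub_floor, e]; ring
      rw [e, e']
      exact ⟨hj, h1⟩
  have hdisj : s.PairwiseDisjoint
      (fun j : ℤ => (fun x => x - (j : ℝ)) ⁻¹' (t ∩ Set.Ico a (a + 1))) := by
    intro i _ j _ hij
    refine Set.disjoint_left.2 ?_
    rintro x ⟨-, h1, h2⟩ ⟨-, h3, h4⟩
    have e1 : ⌊x - a⌋ = i := Int.floor_eq_iff.2 ⟨by linarith, by linarith⟩
    have e2 : ⌊x - a⌋ = j := Int.floor_eq_iff.2 ⟨by linarith, by linarith⟩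
    exact hij (e1.symm.trans e2)
  rw [hset, measure_biUnion s.to_countable hdisj fun j _ =>
    (measurable_id.sub_const _) (ht.inter measurableSet_Ico)]
  simp only [sub_eq_add_neg, measure_preimage_add_right]
  rw [ENNReal.tsum_const, Measure.count_apply hs, Set.encard]

/-- The Bloch coordinates `(j, σ)` of the frequency `(σ₁ + j, σ₂)`, where `σ₁ ∈ [a, a + 1)`. -/
def blochCoord (a : ℝ) (η : Plane) : ℤ × (ℝ × ℝ) :=
  (⌊η 0 - a⌋, (a + Int.fract (η 0 - a), η 1))

/-- The strip `[a, a + 1] × ℝ`. -/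
def strip (a : ℝ) : Set (ℝ × ℝ) := Set.Icc a (a + 1) ×ˢ Set.univ

theorem measurePreserving_blochCoord (a : ℝ) :
    MeasurePreserving (blochCoord a) volume
      (Measure.count.prod ((volume : Measure (ℝ × ℝ)).restrict (strip a))) := by
  have h1 := PiLp.volume_preserving_ofLp (Fin 2)
  have h2 := volume_preserving_finTwoArrow ℝ
  have h3 : MeasurePreserving (Prod.map (foldReal a) (id : ℝ → ℝ)) (volume.prod volume)
      ((Measure.count.prod (volume.restrict (Set.Icc a (a + 1)))).prod volume) :=
    (measurePreserving_foldReal a).prod (MeasurePreserving.id volume)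
  have h4 := measurePreserving_prodAssoc (Measure.count : Measure ℤ)
    ((volume : Measure ℝ).restrict (Set.Icc a (a + 1))) (volume : Measure ℝ)
  have e : (volume : Measure (ℝ × ℝ)).restrict (strip a) =
      ((volume : Measure ℝ).restrict (Set.Icc a (a + 1))).prod volume := by
    rw [strip, Measure.volume_eq_prod, ← Measure.prod_restrict, Measure.restrict_univ]
  rw [e]
  exact h4.comp (h3.comp (h2.comp h1))

theorem measurable_blochCoord (a : ℝ) : Measurable (blochCoord a) :=
  (measurePreserving_blochCoord a).measurable

/-- The dilation by `2π` turns frequencies for the kernel `e^{-2πi⟨ξ, ·⟩}` into wave numbers. Its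
Jacobian in the plane is what the factor `(2π)²` in `blochDensity` compensates. -/
theorem map_blochCoord_smul (a : ℝ) :
    Measure.map (fun ξ : Plane => blochCoord a ((2 * Real.pi) • ξ)) volume =
      ENNReal.ofReal ((2 * Real.pi) ^ 2)⁻¹ •
        (Measure.count.prod ((volume : Measure (ℝ × ℝ)).restrict (strip a))) := by
  have h : (fun ξ : Plane => blochCoord a ((2 * Real.pi) • ξ)) =
      blochCoord a ∘ ((2 * Real.pi) • ·) := rfl
  have hpi : (2 * Real.pi) ≠ 0 := by positivity
  rw [h, ← Measure.map_map (measurable_blochCoord a) (by fun_prop),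
    Measure.map_addHaar_smul _ hpi, Measure.map_smul, (measurePreserving_blochCoord a).map_eq,
    finrank_euclideanSpace_fin, abs_of_pos (by positivity)]

theorem lintegral_blochCoord_smul (a : ℝ) {F : ℤ × (ℝ × ℝ) → ℝ≥0∞} (hF : Measurable F) :
    ∫⁻ ξ : Plane, F (blochCoord a ((2 * Real.pi) • ξ)) =
      ENNReal.ofReal ((2 * Real.pi) ^ 2)⁻¹ * ∫⁻ σ in strip a, ∑' j, F (j, σ) := by
  have hm : Measurable (fun ξ : Plane => blochCoord a ((2 * Real.pi) • ξ)) :=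
    (measurable_blochCoord a).comp (by fun_prop)
  rw [← lintegral_map hF hm, map_blochCoord_smul, lintegral_smul_measure, smul_eq_mul,
    lintegral_prod_symm _ hF.aemeasurable]
  simp only [lintegral_count]

/-! ### Functions with prescribed Bloch coefficients -/

/-- The function on `ℤ × ℝ²` that is `w σ j` at `(j, σ)` for `σ ∈ K` and `0` otherwise. -/
def coeffOn (K : Set (ℝ × ℝ)) (w : ℝ × ℝ → ℤ → ℂ) (z : ℤ × (ℝ × ℝ)) : ℂ :=
  K.indicator (fun σ => w σ z.1) z.2

/-- The Fourier transform of `(x, y) ↦ ∫_K ∑ⱼ w(σ, j) e^{i((σ₁ + j)x + σ₂y)} dσ`. -/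
def blochDensity (a : ℝ) (K : Set (ℝ × ℝ)) (w : ℝ × ℝ → ℤ → ℂ) (ξ : Plane) : ℂ :=
  ((2 * Real.pi) ^ 2 : ℝ) * coeffOn K w (blochCoord a ((2 * Real.pi) • ξ))

section

variable {a D : ℝ} {K : Set (ℝ × ℝ)} {w : ℝ × ℝ → ℤ → ℂ}

theorem measurable_coeffOn (hK : IsCompact K) (hc : ∀ j, ContinuousOn (fun σ => w σ j) K) :
    Measurable (coeffOn K w) := by
  classical
  refine measurable_from_prod_countable_right fun j => ?_
  have h := (hc j).measurable_piecewise (g := 0) continuousOn_const hK.measurableSet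
  simpa [coeffOn, Set.piecewise_eq_indicator] using h

theorem norm_coeffOn_le (hD : ∀ σ ∈ K, ∀ j : ℤ, ‖w σ j‖ ≤ D * (1 + (j : ℝ) ^ 2)⁻¹)
    (z : ℤ × (ℝ × ℝ)) :
    ‖coeffOn K w z‖ ≤ K.indicator (fun _ => D * (1 + (z.1 : ℝ) ^ 2)⁻¹) z.2 := by
  by_cases hz : z.2 ∈ K
  · simpa [coeffOn, hz] using hD z.2 hz z.1
  · simp [coeffOn, hz]

theorem norm_coeffOn_le_const (hD0 : 0 ≤ D)
    (hD : ∀ σ ∈ K, ∀ j : ℤ, ‖w σ j‖ ≤ D * (1 + (j : ℝ) ^ 2)⁻¹) (z : ℤ × (ℝ × ℝ)) :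
    ‖coeffOn K w z‖ ≤ D := by
  refine (norm_coeffOn_le hD z).trans (Set.indicator_apply_le' (fun _ => ?_) fun _ => hD0)
  exact mul_le_of_le_one_right hD0 (inv_le_one_of_one_le₀ (by nlinarith))

theorem integrable_coeffOn (hK : IsCompact K) (hc : ∀ j, ContinuousOn (fun σ => w σ j) K)
    (hD : ∀ σ ∈ K, ∀ j : ℤ, ‖w σ j‖ ≤ D * (1 + (j : ℝ) ^ 2)⁻¹) :
    Integrable (coeffOn K w) (Measure.count.prod (volume.restrict (strip a))) := by
  have hm := measurable_coeffOn hK hc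
  refine ⟨hm.aestronglyMeasurable, ?_⟩
  rw [hasFiniteIntegral_iff_enorm, lintegral_prod_symm _ hm.enorm.aemeasurable]
  simp only [lintegral_count]
  have hS : (∑' j : ℤ, ENNReal.ofReal (|D| * (1 + (j : ℝ) ^ 2)⁻¹)) ≠ ⊤ :=
    (summable_inv_one_add_sq.mul_left |D|).tsum_ofReal_ne_top
  calc _ ≤ ∫⁻ σ in strip a, K.indicator
          (fun _ => ∑' j : ℤ, ENNReal.ofReal (|D| * (1 + (j : ℝ) ^ 2)⁻¹)) σ := by
        refine lintegral_mono fun σ => ?_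
        by_cases hσ : σ ∈ K
        · simp only [hσ, Set.indicator_of_mem]
          refine ENNReal.tsum_le_tsum fun j => ?_
          rw [← ofReal_norm]
          refine ENNReal.ofReal_le_ofReal ?_
          simp only [coeffOn, hσ, Set.indicator_of_mem]
          refine (hD σ hσ j).trans ?_
          gcongr
          exact le_abs_self D
        · simp [coeffOn, hσ]
    _ ≤ ∫⁻ σ, K.indicator
          (fun _ => ∑' j : ℤ, ENNReal.ofReal (|D| * (1 + (j : ℝ) ^ 2)⁻¹)) σ :=
        setLIntegral_le_lintegral _ _
    _ < ⊤ := by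
        rw [lintegral_indicator_const hK.measurableSet]
        exact ENNReal.mul_lt_top hS.lt_top hK.measure_lt_top

/-- A bounded integrable function is square integrable. -/
theorem memLp_two_coeffOn (hK : IsCompact K) (hc : ∀ j, ContinuousOn (fun σ => w σ j) K)
    (hD0 : 0 ≤ D) (hD : ∀ σ ∈ K, ∀ j : ℤ, ‖w σ j‖ ≤ D * (1 + (j : ℝ) ^ 2)⁻¹) :
    MemLp (coeffOn K w) 2 (Measure.count.prod (volume.restrict (strip a))) := by
  have hm := measurable_coeffOn hK hc
  rw [memLp_two_iff_integrable_sq_norm hm.aestronglyMeasurable]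
  refine Integrable.mono' ((integrable_coeffOn (a := a) hK hc hD).norm.const_mul D)
    (hm.norm.pow_const 2).aestronglyMeasurable (Eventually.of_forall fun z => ?_)
  rw [Real.norm_of_nonneg (by positivity), sq]
  gcongr
  exact norm_coeffOn_le_const hD0 hD z

theorem measurable_blochCoord_smul (a : ℝ) :
    Measurable (fun ξ : Plane => blochCoord a ((2 * Real.pi) • ξ)) :=
  (measurable_blochCoord a).comp (by fun_prop)

theorem integrable_blochDensity (hK : IsCompact K) (hc : ∀ j, ContinuousOn (fun σ => w σ j) K)
    (hD : ∀ σ ∈ K, ∀ j : ℤ, ‖w σ j‖ ≤ D * (1 + (j : ℝ) ^ 2)⁻¹) :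
    Integrable (blochDensity a K w) := by
  have h : Integrable (coeffOn K w)
      (Measure.map (fun ξ : Plane => blochCoord a ((2 * Real.pi) • ξ)) volume) := by
    rw [map_blochCoord_smul]
    exact (integrable_coeffOn hK hc hD).smul_measure ENNReal.ofReal_ne_top
  exact (h.comp_measurable (measurable_blochCoord_smul a)).const_mul _

theorem memLp_two_blochDensity (hK : IsCompact K) (hc : ∀ j, ContinuousOn (fun σ => w σ j) K)
    (hD0 : 0 ≤ D) (hD : ∀ σ ∈ K, ∀ j : ℤ, ‖w σ j‖ ≤ D * (1 + (j : ℝ) ^ 2)⁻¹) :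
    MemLp (blochDensity a K w) 2 volume := by
  have h : MemLp (coeffOn K w) 2
      (Measure.map (fun ξ : Plane => blochCoord a ((2 * Real.pi) • ξ)) volume) := by
    rw [map_blochCoord_smul]
    exact (memLp_two_coeffOn hK hc hD0 hD).smul_measure ENNReal.ofReal_ne_top
  exact (h.comp_of_map (measurable_blochCoord_smul a).aemeasurable).const_mul _

/-- The change of variables to Bloch coordinates splits the phase into `e^{i(σ₁x + σ₂y)}` and
`e^{ijx}`; the sum over `j` is then a Fourier series in `x`. As `K` lies in the strip, restricting
to the strip loses nothing. -/
theorem fourierInv_blochDensity (hK : IsCompact K) (hKa : K ⊆ strip a)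
    (hc : ∀ j, ContinuousOn (fun σ => w σ j) K)
    (hD : ∀ σ ∈ K, ∀ j : ℤ, ‖w σ j‖ ≤ D * (1 + (j : ℝ) ^ 2)⁻¹) (p : Plane) :
    𝓕⁻ (blochDensity a K w) p = ∫ σ in K, Complex.exp (Complex.I * (σ.1 * p 0 + σ.2 * p 1)) *
      ∑' j : ℤ, w σ j * Complex.exp (Complex.I * j * p 0) := by
  have hm := measurable_coeffOn hK hc
  let Ψ : ℤ × (ℝ × ℝ) → ℂ := fun z =>
    Complex.exp (Complex.I * (z.2.1 * p 0 + z.2.2 * p 1)) *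
      (coeffOn K w z * Complex.exp (Complex.I * z.1 * p 0))
  have hΨm : Measurable Ψ := by
    have h1 : Measurable (fun z : ℤ × (ℝ × ℝ) => ((z.1 : ℤ) : ℂ)) :=
      (measurable_from_top (f := fun j : ℤ => (j : ℂ))).comp measurable_fst
    fun_prop
  have hΨi : Integrable Ψ (Measure.count.prod (volume.restrict (strip a))) := by
    refine Integrable.mono (integrable_coeffOn (a := a) hK hc hD) hΨm.aestronglyMeasurable
      (Eventually.of_forall fun z => ?_)
    simp only [Ψ, norm_mul, Complex.norm_exp]
    simp
  have hpi : (0 : ℝ) < (2 * Real.pi) ^ 2 := by positivity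
  have e1 : ∀ ξ : Plane, Complex.exp ((↑(2 * Real.pi * inner ℝ ξ p) * Complex.I)) •
      blochDensity a K w ξ =
        (((2 * Real.pi) ^ 2 : ℝ) : ℂ) * Ψ (blochCoord a ((2 * Real.pi) • ξ)) := by
    intro ξ
    simp only [Ψ, blochDensity, smul_eq_mul]
    have hfr : ((blochCoord a ((2 * Real.pi) • ξ)).2.1 : ℝ) +
        ((blochCoord a ((2 * Real.pi) • ξ)).1 : ℝ) = 2 * Real.pi * ξ 0 := by
      simp only [blochCoord, ← Int.self_sub_floor, PiLp.smul_apply, smul_eq_mul]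
      ring
    have hsn : ((blochCoord a ((2 * Real.pi) • ξ)).2.2 : ℝ) = 2 * Real.pi * ξ 1 := by
      simp [blochCoord]
    have hin : 2 * Real.pi * inner ℝ ξ p = (((blochCoord a ((2 * Real.pi) • ξ)).2.1 : ℝ) +
        ((blochCoord a ((2 * Real.pi) • ξ)).1 : ℝ)) * p 0 +
        ((blochCoord a ((2 * Real.pi) • ξ)).2.2 : ℝ) * p 1 := by
      rw [hfr, hsn, PiLp.inner_apply, Fin.sum_univ_two]
      simp only [RCLike.inner_apply, conj_trivial]
      ring
    rw [hin]
    have hexp : ∀ x y z w' : ℂ, Complex.exp x * (y * z) = y * (Complex.exp (x - w') *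
        (z * Complex.exp w')) := by
      intro x y z w'
      rw [Complex.exp_sub]
      field_simp
    rw [hexp _ _ _ (Complex.I * (blochCoord a ((2 * Real.pi) • ξ)).1 * p 0)]
    congr 3
    push_cast
    ring
  rw [Real.fourierInv_eq']
  simp only [e1]
  rw [integral_const_mul, ← integral_map (measurable_blochCoord_smul a).aemeasurable
    hΨm.aestronglyMeasurable, map_blochCoord_smul, integral_smul_measure,
    ENNReal.toReal_ofReal (by positivity), Complex.real_smul, ← mul_assoc, ← Complex.ofReal_mul,
    mul_inv_cancel₀ hpi.ne', Complex.ofReal_one, one_mul, integral_prod_symm _ hΨi]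
  have e2 : ∀ σ : ℝ × ℝ, ∫ j : ℤ, Ψ (j, σ) ∂Measure.count =
      K.indicator (fun σ => Complex.exp (Complex.I * (σ.1 * p 0 + σ.2 * p 1)) *
        ∑' j : ℤ, w σ j * Complex.exp (Complex.I * j * p 0)) σ := by
    intro σ
    by_cases hσ : σ ∈ K
    · have hs : Summable (fun j : ℤ => Ψ (j, σ)) := by
        refine Summable.of_norm_bounded (summable_inv_one_add_sq.mul_left D) fun j => ?_
        have := hD σ hσ j
        simp only [Ψ, norm_mul, Complex.norm_exp]
        simpa [coeffOn, hσ] using this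
      rw [integral_countable (integrable_count_iff.2 hs.norm)]
      simp only [hσ, Set.indicator_of_mem, Measure.real, Measure.count_singleton,
        ENNReal.toReal_one, one_smul, Ψ, coeffOn]
      rw [tsum_mul_left]
    · simp [Ψ, coeffOn, hσ]
  simp only [e2]
  rw [integral_indicator hK.measurableSet, Measure.restrict_restrict hK.measurableSet,
    Set.inter_eq_left.2 hKa]

end

/-! ### The weak form of the eigenvalue equation -/

/-- `e^{i(σ₁x + σ₂y)} w(x)`. -/
def blochWave (σ : ℝ × ℝ) (w : ℝ → ℂ) (p : Plane) : ℂ :=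
  Complex.exp (Complex.I * (σ.1 * p 0 + σ.2 * p 1)) * w (p 0)

theorem norm_blochWave (σ : ℝ × ℝ) (w : ℝ → ℂ) (p : Plane) : ‖blochWave σ w p‖ = ‖w (p 0)‖ := by
  rw [blochWave, norm_mul, Complex.norm_exp]
  simp

theorem continuous_blochWave (σ : ℝ × ℝ) {w : ℝ → ℂ} (hw : Continuous w) :
    Continuous (blochWave σ w) := by
  unfold blochWave
  fun_prop

theorem integrable_blochWave_mul (σ : ℝ × ℝ) {w : ℝ → ℂ} (hw : Continuous w)
    (hp : Function.Periodic w (2 * Real.pi)) (φ : 𝓢(Plane, ℂ)) :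
    Integrable (fun p => blochWave σ w p * φ p) := by
  obtain ⟨C, -, hC⟩ := exists_bound_of_periodic hw hp
  refine φ.integrable.bdd_mul (continuous_blochWave σ hw).aestronglyMeasurable (c := C)
    (Eventually.of_forall fun p => ?_)
  rw [norm_blochWave]
  exact hC _

theorem hasDerivAt_cexp_affine (z c : ℂ) : HasDerivAt (fun t : ℝ => Complex.exp (z + c * t))
    (c * Complex.exp z) 0 := by
  have h1 : HasDerivAt (fun t : ℝ => z + c * (t : ℂ)) c 0 := by
    simpa using ((Complex.ofRealCLM.hasDerivAt (x := (0 : ℝ))).const_mul c).const_add z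
  simpa [mul_comm] using h1.cexp

theorem hasLineDerivAt_blochWave_zero (σ : ℝ × ℝ) {w : ℝ → ℂ} (hw : ContDiff ℝ 1 w) (p : Plane) :
    HasLineDerivAt ℝ (blochWave σ w) (blochWave σ (blochDeriv σ w) p) p
      (EuclideanSpace.single 0 1 : Plane) := by
  have h1 := hasDerivAt_cexp_affine (Complex.I * (σ.1 * p 0 + σ.2 * p 1)) (Complex.I * σ.1)
  have h2 : HasDerivAt (fun t : ℝ => w (p 0 + t)) (deriv w (p 0)) 0 := by
    have := (hw.differentiable one_ne_zero (p 0 + 0)).hasDerivAt.comp_const_add (p 0) 0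
    simpa using this
  have e1 : (fun t : ℝ => blochWave σ w (p + t • (EuclideanSpace.single 0 1 : Plane))) =
      fun t : ℝ => Complex.exp (Complex.I * (σ.1 * p 0 + σ.2 * p 1) + Complex.I * σ.1 * t) *
        w (p 0 + t) := by
    funext t
    simp only [blochWave, PiLp.add_apply, PiLp.smul_apply, PiLp.single_apply, smul_eq_mul]
    norm_num
    left
    congr 1
    ring
  have e2 : blochWave σ (blochDeriv σ w) p =
      Complex.I * σ.1 * Complex.exp (Complex.I * (σ.1 * p 0 + σ.2 * p 1)) * w (p 0 + 0) +
      Complex.exp (Complex.I * (σ.1 * p 0 + σ.2 * p 1) + Complex.I * σ.1 * (0 : ℝ)) *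
        deriv w (p 0) := by
    simp only [blochWave, blochDeriv, Complex.ofReal_zero, mul_zero, add_zero]
    ring
  rw [HasLineDerivAt, e1, e2]
  exact h1.mul h2

theorem hasLineDerivAt_blochWave_one (σ : ℝ × ℝ) (w : ℝ → ℂ) (p : Plane) :
    HasLineDerivAt ℝ (blochWave σ w) (Complex.I * σ.2 * blochWave σ w p) p
      (EuclideanSpace.single 1 1 : Plane) := by
  have h1 := (hasDerivAt_cexp_affine (Complex.I * (σ.1 * p 0 + σ.2 * p 1))
    (Complex.I * σ.2)).mul_const (w (p 0))
  have e1 : (fun t : ℝ => blochWave σ w (p + t • (EuclideanSpace.single 1 1 : Plane))) =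
      fun t : ℝ => Complex.exp (Complex.I * (σ.1 * p 0 + σ.2 * p 1) + Complex.I * σ.2 * t) *
        w (p 0) := by
    funext t
    simp only [blochWave, PiLp.add_apply, PiLp.smul_apply, PiLp.single_apply, smul_eq_mul]
    norm_num
    left
    congr 1
    ring
  have e2 : Complex.I * σ.2 * blochWave σ w p =
      Complex.I * σ.2 * Complex.exp (Complex.I * (σ.1 * p 0 + σ.2 * p 1)) * w (p 0) := by
    simp only [blochWave]
    ring
  rw [HasLineDerivAt, e1, e2]
  exact h1

theorem integral_blochWave_mul_lineDeriv_zero (σ : ℝ × ℝ) {w : ℝ → ℂ} (hw : ContDiff ℝ 1 w)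
    (hp : Function.Periodic w (2 * Real.pi)) (φ : 𝓢(Plane, ℂ)) :
    ∫ p, blochWave σ w p * (∂_{(EuclideanSpace.single 0 1 : Plane)} φ) p =
      -∫ p, blochWave σ (blochDeriv σ w) p * φ p := by
  have hd : ContDiff ℝ 0 (blochDeriv σ w) := contDiff_blochDeriv (n := 0) (by simpa using hw) σ
  refine integral_bilinear_hasLineDerivAt_right_eq_neg_left_of_integrable
    (B := ContinuousLinearMap.mul ℝ ℂ)
    (integrable_blochWave_mul σ hd.continuous (periodic_blochDeriv hp σ) φ)
    (integrable_blochWave_mul σ hw.continuous hp _)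
    (integrable_blochWave_mul σ hw.continuous hp _)
    (fun p _ => hasLineDerivAt_blochWave_zero σ hw p) (fun p _ => ?_)
  rw [SchwartzMap.lineDerivOp_apply]
  exact (φ.differentiableAt.lineDifferentiableAt).hasLineDerivAt

theorem integral_blochWave_mul_lineDeriv_one (σ : ℝ × ℝ) {w : ℝ → ℂ} (hw : Continuous w)
    (hp : Function.Periodic w (2 * Real.pi)) (φ : 𝓢(Plane, ℂ)) :
    ∫ p, blochWave σ w p * (∂_{(EuclideanSpace.single 1 1 : Plane)} φ) p =
      -(Complex.I * σ.2 * ∫ p, blochWave σ w p * φ p) := by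
  rw [← integral_const_mul]
  simp only [← mul_assoc (Complex.I * (σ.2 : ℂ))]
  refine integral_bilinear_hasLineDerivAt_right_eq_neg_left_of_integrable
    (B := ContinuousLinearMap.mul ℝ ℂ) ?_
    (integrable_blochWave_mul σ hw hp _)
    (integrable_blochWave_mul σ hw hp _)
    (fun p _ => hasLineDerivAt_blochWave_one σ w p) (fun p _ => ?_)
  · simpa [mul_assoc] using (integrable_blochWave_mul σ hw hp φ).const_mul (Complex.I * (σ.2 : ℂ))
  rw [SchwartzMap.lineDerivOp_apply]
  exact (φ.differentiableAt.lineDifferentiableAt).hasLineDerivAt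

/-- `1 + (1 + 2εω)∂ₓ² + ∂_y²` on Schwartz functions. -/
def planeOpTest (ε ω : ℝ) (φ : 𝓢(Plane, ℂ)) : 𝓢(Plane, ℂ) :=
  φ + ((1 + 2 * ε * ω : ℝ) : ℂ) •
      ∂_{(EuclideanSpace.single 0 1 : Plane)} (∂_{(EuclideanSpace.single 0 1 : Plane)} φ) +
    ∂_{(EuclideanSpace.single 1 1 : Plane)} (∂_{(EuclideanSpace.single 1 1 : Plane)} φ)

/-- Every derivative occurs twice, so the signs from duality cancel and the operator is its own
transpose. -/
theorem planeOp_apply (ε ω : ℝ) (T : 𝓢'(Plane, ℂ)) (φ : 𝓢(Plane, ℂ)) :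
    planeOp ε ω T φ = T (planeOpTest ε ω φ) := by
  have hneg : ∀ (m : Plane) (ψ : 𝓢(Plane, ℂ)), ∂_{m} (-ψ) = -∂_{m} ψ :=
    fun m ψ => map_neg (LineDeriv.lineDerivOpCLM ℂ 𝓢(Plane, ℂ) m) ψ
  have hl : ∀ m : Plane, (∂_{m} (∂_{m} T)) φ = T (∂_{m} (∂_{m} φ)) := by
    intro m
    rw [lineDerivOp_apply_apply, lineDerivOp_apply_apply, hneg, neg_neg]
  rw [planeOp, planeOpTest, map_add, map_add, map_smul, ← hl, ← hl]
  rfl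

/-- On a Bloch wave `∂ₓ` acts as `∂ₓ + iσ₁` on the profile and `∂_y` as `iσ₂`. The wave is bounded,
so integration by parts against a Schwartz function leaves no boundary terms. -/
theorem integral_blochWave_mul_planeOpTest (ε ω : ℝ) (σ : ℝ × ℝ) {w : ℝ → ℂ} (hw : ContDiff ℝ 2 w)
    (hp : Function.Periodic w (2 * Real.pi)) (φ : 𝓢(Plane, ℂ)) :
    ∫ p, blochWave σ w p * planeOpTest ε ω φ p =
      ∫ p, blochWave σ (blochInner ε ω σ w) p * φ p := by
  have hw1 : ContDiff ℝ 1 w := hw.of_le (by norm_num)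
  have hd1 : ContDiff ℝ 1 (blochDeriv σ w) := contDiff_blochDeriv (n := 1) (by exact_mod_cast hw) σ
  have hd2 : ContDiff ℝ 0 (blochDeriv σ (blochDeriv σ w)) :=
    contDiff_blochDeriv (n := 0) (by simpa using hd1) σ
  have hp1 := periodic_blochDeriv hp σ
  have e1 : ∀ p, blochWave σ w p * planeOpTest ε ω φ p = blochWave σ w p * φ p +
      ((1 + 2 * ε * ω : ℝ) : ℂ) * (blochWave σ w p *
        (∂_{(EuclideanSpace.single 0 1 : Plane)} (∂_{(EuclideanSpace.single 0 1 : Plane)} φ)) p) +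
      blochWave σ w p *
        (∂_{(EuclideanSpace.single 1 1 : Plane)} (∂_{(EuclideanSpace.single 1 1 : Plane)} φ)) p := by
    intro p
    simp only [planeOpTest, add_apply, smul_apply, smul_eq_mul]
    ring
  have e2 : ∀ p, blochWave σ (blochInner ε ω σ w) p * φ p = blochWave σ w p * φ p +
      ((1 + 2 * ε * ω : ℝ) : ℂ) * (blochWave σ (blochDeriv σ (blochDeriv σ w)) p * φ p) +
      (-(σ.2 : ℂ) ^ 2) * (blochWave σ w p * φ p) := by
    intro p
    simp only [blochWave, blochInner]
    ring
  have i0 := fun ψ : 𝓢(Plane, ℂ) => integrable_blochWave_mul σ hw.continuous hp ψ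
  have i2 := integrable_blochWave_mul σ hd2.continuous (periodic_blochDeriv hp1 σ) φ
  simp only [e1, e2]
  rw [integral_add ((i0 _).fun_add ((i0 _).const_mul _)) (i0 _),
    integral_add (i0 _) ((i0 _).const_mul _),
    integral_add ((i0 _).fun_add (i2.const_mul _)) ((i0 _).const_mul _),
    integral_add (i0 _) (i2.const_mul _), integral_const_mul, integral_const_mul,
    integral_const_mul, integral_blochWave_mul_lineDeriv_zero σ hw1 hp,
    integral_blochWave_mul_lineDeriv_zero σ hd1 hp1,
    integral_blochWave_mul_lineDeriv_one σ hw.continuous hp,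
    integral_blochWave_mul_lineDeriv_one σ hw.continuous hp]
  linear_combination ((σ.2 : ℂ) ^ 2 * ∫ p, blochWave σ w p * φ p) * Complex.I_sq

/-- A single Bloch wave is not in `L²(ℝ²)`, so the eigenvalue equation is put in a weak form that
can be integrated over `σ`. -/
theorem integral_blochWave_mul_planeOpTest_planeOpTest {ε ω b s μ : ℝ} {u : ℝ → ℝ}
    (hu : Continuous u) (hup : Function.Periodic u (2 * Real.pi)) {σ : ℝ × ℝ} {w : ℝ → ℂ}
    (hw : IsBlochEigenfunction ε ω b s u σ μ w) (φ : 𝓢(Plane, ℂ)) :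
    (μ : ℂ) * ∫ p, blochWave σ w p * φ p =
      -(∫ p, blochWave σ w p * planeOpTest ε ω (planeOpTest ε ω φ) p) +
        ∫ p, (potential ε b s u (p 0) : ℂ) * (blochWave σ w p * φ p) := by
  obtain ⟨hd, hp, -, he⟩ := hw
  have hP : ContDiff ℝ 2 (blochInner ε ω σ w) :=
    contDiff_blochInner (n := 2) (by norm_num; exact hd) ε ω σ
  have hPP : ContDiff ℝ 0 (blochInner ε ω σ (blochInner ε ω σ w)) :=
    contDiff_blochInner (n := 0) (by norm_num; exact hP) ε ω σ
  have hpP := periodic_blochInner hp ε ω σ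
  have hq := continuous_potential hu ε b s
  have iq : Integrable (fun p : Plane => (potential ε b s u (p 0) : ℂ) *
      (blochWave σ w p * φ p)) := by
    have hqp : Function.Periodic (fun x => (potential ε b s u x : ℂ) * w x) (2 * Real.pi) := by
      intro x
      simp only [potential, hup x, hp x]
    have := integrable_blochWave_mul σ (w := fun x => (potential ε b s u x : ℂ) * w x)
      ((Complex.continuous_ofReal.comp hq).mul hd.continuous) hqp φ
    refine this.congr (Eventually.of_forall fun p => ?_)
    simp only [blochWave]
    ring
  rw [integral_blochWave_mul_planeOpTest ε ω σ (hd.of_le (by norm_num)) hp,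
    integral_blochWave_mul_planeOpTest ε ω σ hP hpP, ← integral_const_mul, ← integral_neg,
    ← integral_add (integrable_blochWave_mul σ hPP.continuous
      (periodic_blochInner hpP ε ω σ) φ).fun_neg iq]
  refine integral_congr_ae (Eventually.of_forall fun p => ?_)
  have h := he (p 0)
  simp only [blochOp] at h
  simp only [blochWave]
  linear_combination -(Complex.exp (Complex.I * (σ.1 * p 0 + σ.2 * p 1)) * φ p) * h

/-! ### Superpositions of Bloch waves -/

section

variable {K : Set (ℝ × ℝ)} {W : ℝ × ℝ → ℝ → ℂ} {A : ℝ × ℝ → ℂ} {D : ℝ}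

theorem integrable_prod_blochWave (hK : IsCompact K) (hA : ContinuousOn A K)
    (hc : ContinuousOn (fun z : (ℝ × ℝ) × ℝ => W z.1 z.2) (K ×ˢ Set.univ))
    (hD : ∀ σ ∈ K, ∀ x, ‖W σ x‖ ≤ D) {Q : ℝ → ℂ} (hQ : Continuous Q) {M : ℝ}
    (hM : ∀ x, ‖Q x‖ ≤ M) (ψ : 𝓢(Plane, ℂ)) :
    Integrable (fun z : (ℝ × ℝ) × Plane => A z.1 * (Q (z.2 0) *
      (blochWave z.1 (W z.1) z.2 * ψ z.2))) ((volume.restrict K).prod volume) := by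
  have hcont : ContinuousOn (fun z : (ℝ × ℝ) × Plane => A z.1 * (Q (z.2 0) *
      (blochWave z.1 (W z.1) z.2 * ψ z.2))) (K ×ˢ Set.univ) := by
    have h1 : ContinuousOn (fun z : (ℝ × ℝ) × Plane => A z.1) (K ×ˢ Set.univ) :=
      hA.comp continuousOn_fst fun z hz => hz.1
    have h2 : ContinuousOn (fun z : (ℝ × ℝ) × Plane => W z.1 (z.2 0)) (K ×ˢ Set.univ) :=
      hc.comp (f := fun z : (ℝ × ℝ) × Plane => (z.1, z.2 0)) (by fun_prop)
        fun z hz => ⟨hz.1, Set.mem_univ _⟩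
    have h3 : Continuous (fun z : (ℝ × ℝ) × Plane => ψ z.2) := ψ.continuous.comp continuous_snd
    have h4 : Continuous (fun z : (ℝ × ℝ) × Plane => Q (z.2 0)) := by fun_prop
    have h5 : Continuous (fun z : (ℝ × ℝ) × Plane =>
      Complex.exp (Complex.I * (z.1.1 * z.2 0 + z.1.2 * z.2 1))) := by fun_prop
    exact h1.mul (h4.continuousOn.mul ((h5.continuousOn.mul h2).mul h3.continuousOn))
  obtain ⟨E, hE⟩ := hK.exists_bound_of_continuousOn hA
  have hprod : ((volume : Measure (ℝ × ℝ)).restrict K).prod (volume : Measure Plane) =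
      (volume.prod volume).restrict (K ×ˢ Set.univ) := by
    rw [← Measure.prod_restrict, Measure.restrict_univ]
  have hconst : Integrable (fun _ : ℝ × ℝ => |E| * |M| * |D|) (volume.restrict K) :=
    integrableOn_const hK.measure_lt_top.ne
  refine Integrable.mono' (hconst.mul_prod (ψ.integrable (μ := volume)).norm) ?_ ?_
  · rw [hprod]
    exact hcont.aestronglyMeasurable (hK.measurableSet.prod MeasurableSet.univ)
  · rw [hprod, ae_restrict_iff' (hK.measurableSet.prod MeasurableSet.univ)]
    refine Eventually.of_forall fun z hz => ?_
    rw [norm_mul, norm_mul, norm_mul, norm_blochWave]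
    have h1 := (hE z.1 hz.1).trans (le_abs_self E)
    have h2 := (hM (z.2 0)).trans (le_abs_self M)
    have h3 := (hD z.1 hz.1 (z.2 0)).trans (le_abs_self D)
    calc _ ≤ |E| * (|M| * (|D| * ‖ψ z.2‖)) := by gcongr
      _ = _ := by ring

/-- Fubini; it is applied with `Q = 1` and with `Q` the potential. -/
theorem integral_superposition_mul (hK : IsCompact K) (hA : ContinuousOn A K)
    (hc : ContinuousOn (fun z : (ℝ × ℝ) × ℝ => W z.1 z.2) (K ×ˢ Set.univ))
    (hD : ∀ σ ∈ K, ∀ x, ‖W σ x‖ ≤ D) {Q : ℝ → ℂ} (hQ : Continuous Q) {M : ℝ}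
    (hM : ∀ x, ‖Q x‖ ≤ M) (ψ : 𝓢(Plane, ℂ)) :
    Integrable (fun σ => A σ * ∫ p : Plane, Q (p 0) * (blochWave σ (W σ) p * ψ p))
      (volume.restrict K) ∧
    ∫ p : Plane, Q (p 0) * ((∫ σ in K, A σ * blochWave σ (W σ) p) * ψ p) =
      ∫ σ in K, A σ * ∫ p : Plane, Q (p 0) * (blochWave σ (W σ) p * ψ p) := by
  have h := integrable_prod_blochWave hK hA hc hD hQ hM ψ
  have e : ∀ σ : ℝ × ℝ, ∫ p : Plane, A σ * (Q (p 0) * (blochWave σ (W σ) p * ψ p)) =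
      A σ * ∫ p : Plane, Q (p 0) * (blochWave σ (W σ) p * ψ p) := fun σ => integral_const_mul _ _
  refine ⟨h.integral_prod_left.congr (Eventually.of_forall e), ?_⟩
  calc _ = ∫ p : Plane, ∫ σ in K, A σ * (Q (p 0) * (blochWave σ (W σ) p * ψ p)) := by
        refine integral_congr_ae (Eventually.of_forall fun p => ?_)
        simp only
        rw [← integral_mul_const, ← integral_const_mul]
        refine integral_congr_ae (Eventually.of_forall fun σ => ?_)
        simp only
        ring
    _ = ∫ σ in K, ∫ p : Plane, A σ * (Q (p 0) * (blochWave σ (W σ) p * ψ p)) :=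
        (integral_integral_swap h).symm
    _ = _ := by simp only [e]

/-- A superposition of eigenfunctions lies in the domain of the linearized operator, which acts on
it by multiplying the amplitudes by the eigenvalues. -/
theorem linearizedOp_superposition {ε ω b s M : ℝ} (hk : 0 < 1 + 2 * ε * ω) {u : ℝ → ℝ}
    (hu : Continuous u) (hup : Function.Periodic u (2 * Real.pi))
    (hM : ∀ x, |potential ε b s u x| ≤ M) {lam : ℝ × ℝ → ℝ}
    (hW : ∀ σ ∈ K, IsBlochEigenfunction ε ω b s u σ (lam σ) (W σ))
    (hK : IsCompact K) (hA : ContinuousOn A K) (hl : ContinuousOn lam K)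
    (hc : ContinuousOn (fun z : (ℝ × ℝ) × ℝ => W z.1 z.2) (K ×ˢ Set.univ))
    (hD : ∀ σ ∈ K, ∀ x, ‖W σ x‖ ≤ D) {v f : L2Plane}
    (hv : ∀ᵐ p : Plane, v p = ∫ σ in K, A σ * blochWave σ (W σ) p)
    (hf : ∀ᵐ p : Plane, f p = ∫ σ in K, (lam σ * A σ) * blochWave σ (W σ) p) :
    LinearizedOp ε ω b s u v f := by
  have hq := continuous_potential hu ε b s
  have hqc : Continuous (fun x => (potential ε b s u x : ℂ)) := Complex.continuous_ofReal.comp hq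
  have hqM : ∀ x, ‖(potential ε b s u x : ℂ)‖ ≤ M := fun x => by
    rw [Complex.norm_real]; exact hM x
  have hlA : ContinuousOn (fun σ => (lam σ : ℂ) * A σ) K :=
    (Complex.continuous_ofReal.comp_continuousOn hl).mul hA
  have hg : MemLp (fun p : Plane => (potential ε b s u (p 0) : ℂ) * v p) 2 volume := by
    refine MemLp.of_le_mul (c := M) (Lp.memLp v) ?_ (Eventually.of_forall fun p => ?_)
    · exact (Continuous.aestronglyMeasurable (by fun_prop)).mul (Lp.aestronglyMeasurable v)
    · rw [norm_mul]
      gcongr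
      exact hqM _
  have heq : (f : 𝓢'(Plane, ℂ)) = -planeOp ε ω (planeOp ε ω (v : 𝓢'(Plane, ℂ))) +
      ((hg.toLp : L2Plane) : 𝓢'(Plane, ℂ)) := by
    ext φ
    have h1 := integral_superposition_mul hK hA hc hD (Q := fun _ => 1) continuous_const
      (M := 1) (by simp) (planeOpTest ε ω (planeOpTest ε ω φ))
    have h2 := integral_superposition_mul hK hA hc hD hqc hqM φ
    have h3 := integral_superposition_mul hK hlA hc hD (Q := fun _ => 1) continuous_const
      (M := 1) (by simp) φ
    simp only [one_mul] at h1 h3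
    have e1 : (f : 𝓢'(Plane, ℂ)) φ =
        ∫ σ in K, (lam σ * A σ) * ∫ p : Plane, blochWave σ (W σ) p * φ p := by
      rw [Lp.toTemperedDistribution_apply, ← h3.2]
      refine integral_congr_ae ?_
      filter_upwards [hf] with p hp
      rw [hp, smul_eq_mul, mul_comm]
    have e2 : planeOp ε ω (planeOp ε ω (v : 𝓢'(Plane, ℂ))) φ = ∫ σ in K, A σ *
        ∫ p : Plane, blochWave σ (W σ) p * planeOpTest ε ω (planeOpTest ε ω φ) p := by
      rw [planeOp_apply, planeOp_apply, Lp.toTemperedDistribution_apply, ← h1.2]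
      refine integral_congr_ae ?_
      filter_upwards [hv] with p hp
      rw [hp, smul_eq_mul, mul_comm]
    have e3 : ((hg.toLp : L2Plane) : 𝓢'(Plane, ℂ)) φ = ∫ σ in K, A σ *
        ∫ p : Plane, (potential ε b s u (p 0) : ℂ) * (blochWave σ (W σ) p * φ p) := by
      rw [Lp.toTemperedDistribution_apply, ← h2.2]
      refine integral_congr_ae ?_
      filter_upwards [hv, hg.coeFn_toLp] with p hp hp'
      rw [hp', hp, smul_eq_mul]
      ring
    have e4 : (-planeOp ε ω (planeOp ε ω (v : 𝓢'(Plane, ℂ))) +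
        ((hg.toLp : L2Plane) : 𝓢'(Plane, ℂ))) φ =
        -(planeOp ε ω (planeOp ε ω (v : 𝓢'(Plane, ℂ))) φ) +
          ((hg.toLp : L2Plane) : 𝓢'(Plane, ℂ)) φ := rfl
    rw [e4, e1, e2, e3, ← integral_neg, ← integral_add h1.1.fun_neg h2.1]
    refine setIntegral_congr_fun hK.measurableSet fun σ hσ => ?_
    have h := integral_blochWave_mul_planeOpTest_planeOpTest hu hup (hW σ hσ) φ
    simp only
    linear_combination A σ * h
  -- The weak equation writes the fourth-order part of `v` as a difference of two `L²` functions, so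
  -- `H⁴` follows from ellipticity.
  refine ⟨memSobolev_four_of_eq_planeOp_planeOp hk (h := hg.toLp - f) ?_, hg.toLp,
    hg.coeFn_toLp, heq⟩
  have : ((hg.toLp - f : L2Plane) : 𝓢'(Plane, ℂ)) =
      ((hg.toLp : L2Plane) : 𝓢'(Plane, ℂ)) - (f : 𝓢'(Plane, ℂ)) :=
    map_sub (Lp.toTemperedDistributionCLM ℂ (volume : Measure Plane) 2) _ _
  rw [this, heq]
  abel

end

/-! ### Evolution of the spectral density and its Sobolev norm -/

section

variable {a D : ℝ} {K : Set (ℝ × ℝ)} {W : ℝ × ℝ → ℝ → ℂ} {lam : ℝ × ℝ → ℝ}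

/-- The Bloch coefficients `A(σ) Ŵ(σ, j)`. -/
def scaledCoeff (W : ℝ × ℝ → ℝ → ℂ) (A : ℝ × ℝ → ℂ) (σ : ℝ × ℝ) (j : ℤ) : ℂ :=
  A σ * torusCoeff (W σ) j

theorem continuousOn_scaledCoeff {A : ℝ × ℝ → ℂ} (hA : ContinuousOn A K)
    (hc : ∀ j, ContinuousOn (fun σ => torusCoeff (W σ) j) K) (j : ℤ) :
    ContinuousOn (fun σ => scaledCoeff W A σ j) K :=
  hA.mul (hc j)

theorem exists_norm_scaledCoeff_le {A : ℝ × ℝ → ℂ} (hK : IsCompact K) (hA : ContinuousOn A K)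
    (hD : ∀ σ ∈ K, ∀ j : ℤ, ‖torusCoeff (W σ) j‖ ≤ D * (1 + (j : ℝ) ^ 2)⁻¹) :
    ∃ D', 0 ≤ D' ∧ ∀ σ ∈ K, ∀ j : ℤ, ‖scaledCoeff W A σ j‖ ≤ D' * (1 + (j : ℝ) ^ 2)⁻¹ := by
  obtain ⟨E, hE⟩ := hK.exists_bound_of_continuousOn hA
  refine ⟨|E| * |D|, by positivity, fun σ hσ j => ?_⟩
  rw [scaledCoeff, norm_mul, mul_assoc]
  have h1 := (hE σ hσ).trans (le_abs_self E)
  have h2 := (hD σ hσ j).trans (mul_le_mul_of_nonneg_right (le_abs_self D) (by positivity))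
  gcongr

theorem memLp_scaledDensity {A : ℝ × ℝ → ℂ} (hK : IsCompact K) (hA : ContinuousOn A K)
    (hc : ∀ j, ContinuousOn (fun σ => torusCoeff (W σ) j) K)
    (hD : ∀ σ ∈ K, ∀ j : ℤ, ‖torusCoeff (W σ) j‖ ≤ D * (1 + (j : ℝ) ^ 2)⁻¹) :
    MemLp (blochDensity a K (scaledCoeff W A)) 2 volume := by
  obtain ⟨D', hD0, hD'⟩ := exists_norm_scaledCoeff_le hK hA hD
  exact memLp_two_blochDensity hK (continuousOn_scaledCoeff hA hc) hD0 hD'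

theorem fourierInv_scaledDensity_ae_eq {A : ℝ × ℝ → ℂ} (hK : IsCompact K) (hKa : K ⊆ strip a)
    (hA : ContinuousOn A K)
    (hc : ∀ j, ContinuousOn (fun σ => torusCoeff (W σ) j) K)
    (hD : ∀ σ ∈ K, ∀ j : ℤ, ‖torusCoeff (W σ) j‖ ≤ D * (1 + (j : ℝ) ^ 2)⁻¹)
    (hs : ∀ σ ∈ K, ∀ x : ℝ,
      HasSum (fun j : ℤ => torusCoeff (W σ) j * Complex.exp (Complex.I * j * x)) (W σ x))
    (hG : MemLp (blochDensity a K (scaledCoeff W A)) 2 volume) :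
    ∀ᵐ p : Plane, (𝓕⁻ hG.toLp : L2Plane) p = ∫ σ in K, A σ * blochWave σ (W σ) p := by
  obtain ⟨D', hD0, hD'⟩ := exists_norm_scaledCoeff_le hK hA hD
  have hcA := continuousOn_scaledCoeff hA hc
  filter_upwards [fourierInv_toLp_ae_eq (integrable_blochDensity hK hcA hD') hG] with p hp
  rw [hp, fourierInv_blochDensity hK hKa hcA hD']
  refine setIntegral_congr_fun hK.measurableSet fun σ hσ => ?_
  simp only [scaledCoeff, mul_assoc, tsum_mul_left]
  have h := (hs σ hσ (p 0)).tsum_eq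
  simp only [mul_assoc] at h
  rw [h, blochWave]
  ring

theorem coeffOn_scaledCoeff (A : ℝ × ℝ → ℂ) (z : ℤ × (ℝ × ℝ)) :
    coeffOn K (scaledCoeff W A) z = K.indicator A z.2 * coeffOn K (fun σ => torusCoeff (W σ)) z := by
  by_cases hz : z.2 ∈ K <;> simp [coeffOn, scaledCoeff, hz]

/-- The amplitude `e^{λ(σ)t}`. -/
def growth (lam : ℝ × ℝ → ℝ) (t : ℝ) (σ : ℝ × ℝ) : ℂ := (Real.exp (lam σ * t) : ℝ)

theorem continuousOn_growth (hl : ContinuousOn lam K) (t : ℝ) :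
    ContinuousOn (growth lam t) K := by
  unfold growth
  fun_prop

/-- The evolution is multiplication by `e^{λ(σ)t}` with `λ` bounded on `K`. The remainder bound
`|e^x - 1 - x| ≤ x²` for `|x| ≤ 1` therefore holds uniformly over frequencies, and the error is
`O(h²)` in `L²`. -/
theorem hasDerivAt_toLp_scaledDensity (hK : IsCompact K) (hl : ContinuousOn lam K)
    (hG : ∀ t, MemLp (blochDensity a K (scaledCoeff W (growth lam t))) 2 volume)
    (hG' : ∀ t, MemLp (blochDensity a K (scaledCoeff W (fun σ => lam σ * growth lam t σ))) 2
      volume) (t : ℝ) :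
    HasDerivAt (fun t => ((hG t).toLp : L2Plane)) ((hG' t).toLp) t := by
  obtain ⟨L, hL⟩ := hK.exists_bound_of_continuousOn hl
  have hL' : ∀ σ ∈ K, |lam σ| ≤ |L| + 1 := fun σ hσ => by
    have := (hL σ hσ).trans (le_abs_self L)
    rw [Real.norm_eq_abs] at this
    linarith
  have hL0 : 0 < |L| + 1 := by positivity
  rw [hasDerivAt_iff_isLittleO_nhds_zero]
  refine Asymptotics.IsBigO.trans_isLittleO ?_ (Asymptotics.isLittleO_pow_id (one_lt_two))
  refine Asymptotics.IsBigO.of_bound ((|L| + 1) ^ 2 * ‖((hG t).toLp : L2Plane)‖) ?_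
  have hev : ∀ᶠ h : ℝ in 𝓝 0, |h| * (|L| + 1) < 1 := by
    have : Continuous (fun h : ℝ => |h| * (|L| + 1)) := by fun_prop
    exact this.tendsto 0 |>.eventually_lt_const (by simp)
  filter_upwards [hev] with h hh
  have key : ‖((hG (t + h)).toLp - (hG t).toLp - h • (hG' t).toLp : L2Plane)‖ ≤
      ((|L| + 1) * |h|) ^ 2 * ‖((hG t).toLp : L2Plane)‖ := by
    refine Lp.norm_le_mul_norm_of_ae_le_mul ?_
    filter_upwards [Lp.coeFn_sub ((hG (t + h)).toLp - (hG t).toLp : L2Plane) (h • (hG' t).toLp),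
      Lp.coeFn_sub ((hG (t + h)).toLp : L2Plane) (hG t).toLp,
      Lp.coeFn_smul h ((hG' t).toLp : L2Plane), (hG (t + h)).coeFn_toLp, (hG t).coeFn_toLp,
      (hG' t).coeFn_toLp] with ξ h1 h2 h3 h4 h5 h6
    rw [h1, Pi.sub_apply, h2, Pi.sub_apply, h3, Pi.smul_apply, h4, h5, h6]
    simp only [blochDensity, coeffOn_scaledCoeff]
    set z := blochCoord a ((2 * Real.pi) • ξ)
    by_cases hz : z.2 ∈ K
    · simp only [hz, Set.indicator_of_mem, growth, Complex.real_smul]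
      set l := lam z.2
      have hlz : |h * l| ≤ 1 := by
        rw [abs_mul]
        have := mul_le_mul_of_nonneg_left (hL' z.2 hz) (abs_nonneg h)
        linarith
      have hexp := Real.abs_exp_sub_one_sub_id_le hlz
      have e : Real.exp (l * (t + h)) = Real.exp (l * t) * Real.exp (h * l) := by
        rw [← Real.exp_add]; ring_nf
      rw [e]
      have e2 : ∀ c d : ℂ, c * (((Real.exp (l * t) * Real.exp (h * l) : ℝ) : ℂ) * d) -
          c * ((Real.exp (l * t) : ℝ) * d) - h * (c * (l * (Real.exp (l * t) : ℝ) * d)) =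
          ((Real.exp (h * l) - 1 - h * l : ℝ) : ℂ) * (c * ((Real.exp (l * t) : ℝ) * d)) := by
        intro c d
        push_cast
        ring
      rw [e2, norm_mul, Complex.norm_real, Real.norm_eq_abs]
      gcongr
      refine hexp.trans ?_
      rw [← sq_abs, abs_mul, mul_comm]
      have := hL' z.2 hz
      gcongr
    · simp [hz]
  refine key.trans (le_of_eq ?_)
  rw [Real.norm_eq_abs, abs_pow]
  ring

/-! ### Plancherel in Bloch coordinates and comparison of Sobolev norms -/

/-- As `σ` stays bounded, the planar weight at `(σ₁ + j, σ₂)` and the weight at `j` on the torus are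
comparable uniformly in `j`. -/
theorem exists_weight_comparison (hK : IsCompact K) :
    ∃ c, 0 < c ∧ ∀ σ ∈ K, ∀ j : ℤ, 1 + (j : ℝ) ^ 2 ≤ c * (1 + (σ.1 + j) ^ 2 + σ.2 ^ 2) ∧
      1 + (σ.1 + j) ^ 2 + σ.2 ^ 2 ≤ c * (1 + (j : ℝ) ^ 2) := by
  obtain ⟨R, hR⟩ := hK.exists_bound_of_continuousOn (f := fun σ : ℝ × ℝ => σ) continuousOn_id
  refine ⟨2 + 3 * R ^ 2, by positivity, fun σ hσ j => ?_⟩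
  have h := hR σ hσ
  have h1 : |σ.1| ≤ R := (norm_fst_le σ).trans h
  have h2 : |σ.2| ≤ R := (norm_snd_le σ).trans h
  have h3 : σ.1 ^ 2 ≤ R ^ 2 := sq_le_sq' (abs_le.1 h1).1 (abs_le.1 h1).2
  have h4 : σ.2 ^ 2 ≤ R ^ 2 := sq_le_sq' (abs_le.1 h2).1 (abs_le.1 h2).2
  have h5 : 0 ≤ R ^ 2 * (j : ℝ) ^ 2 := by positivity
  have h6 : 0 ≤ R ^ 2 * (σ.1 + j) ^ 2 := by positivity
  have h7 : 0 ≤ R ^ 2 * σ.2 ^ 2 := by positivity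
  constructor
  · nlinarith [sq_nonneg (2 * σ.1 + j), sq_nonneg σ.2]
  · nlinarith [sq_nonneg (σ.1 - j)]

/-- Plancherel without cross terms, since almost every frequency determines `(j, σ)`. The factor
`(2π)²` is the squared normalization `(2π)⁴` of the density divided by the Jacobian `(2π)²`.
Extended nonnegative values make a prior finiteness proof unnecessary. -/
theorem sobolevNorm_two_sq (hK : IsCompact K) (hKa : K ⊆ strip a) (hl : ContinuousOn lam K)
    (hc : ∀ j, ContinuousOn (fun σ => torusCoeff (W σ) j) K) {t : ℝ}
    (hG : MemLp (blochDensity a K (scaledCoeff W (growth lam t))) 2 volume) :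
    (eLpNorm (fun ξ : Plane => (((1 + (2 * Real.pi * ‖ξ‖) ^ 2) ^ (((2 : ℕ) : ℝ) / 2) : ℝ) : ℂ) *
      (𝓕 (𝓕⁻ hG.toLp : L2Plane) : L2Plane) ξ) 2 volume) ^ 2 =
    ENNReal.ofReal ((2 * Real.pi) ^ 2) * ∫⁻ σ in K, ENNReal.ofReal (Real.exp (2 * lam σ * t)) *
      ∑' j : ℤ, ENNReal.ofReal ((1 + (σ.1 + j) ^ 2 + σ.2 ^ 2) ^ 2 * ‖torusCoeff (W σ) j‖ ^ 2) := by
  have hcA := continuousOn_scaledCoeff (continuousOn_growth hl t) hc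
  have hm := measurable_coeffOn hK hcA
  let F : ℤ × (ℝ × ℝ) → ℝ≥0∞ := fun z =>
    ENNReal.ofReal (((1 + (z.2.1 + z.1) ^ 2 + z.2.2 ^ 2) * ((2 * Real.pi) ^ 2 *
      ‖coeffOn K (scaledCoeff W (growth lam t)) z‖)) ^ 2)
  have hF : Measurable F := by
    have h1 : Measurable (fun z : ℤ × (ℝ × ℝ) => ((z.1 : ℤ) : ℝ)) :=
      (measurable_from_top (f := fun j : ℤ => (j : ℝ))).comp measurable_fst
    fun_prop
  have e0 : (eLpNorm (fun ξ : Plane =>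
      (((1 + (2 * Real.pi * ‖ξ‖) ^ 2) ^ (((2 : ℕ) : ℝ) / 2) : ℝ) : ℂ) *
      (𝓕 (𝓕⁻ hG.toLp : L2Plane) : L2Plane) ξ) 2 volume) ^ 2 =
      ∫⁻ ξ : Plane, F (blochCoord a ((2 * Real.pi) • ξ)) := by
    have h2 := eLpNorm_nnreal_pow_eq_lintegral (μ := (volume : Measure Plane)) (p := 2)
      (f := fun ξ : Plane => (((1 + (2 * Real.pi * ‖ξ‖) ^ 2) ^ (((2 : ℕ) : ℝ) / 2) : ℝ) : ℂ) *
      (𝓕 (𝓕⁻ hG.toLp : L2Plane) : L2Plane) ξ) two_ne_zero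
    simp only [NNReal.coe_ofNat, ENNReal.coe_ofNat, ENNReal.rpow_ofNat] at h2
    rw [h2, fourier_fourierInv_eq]
    refine lintegral_congr_ae ?_
    filter_upwards [hG.coeFn_toLp] with ξ hξ
    rw [hξ]
    have hfr : ((blochCoord a ((2 * Real.pi) • ξ)).2.1 : ℝ) +
        ((blochCoord a ((2 * Real.pi) • ξ)).1 : ℝ) = 2 * Real.pi * ξ 0 := by
      simp only [blochCoord, ← Int.self_sub_floor, PiLp.smul_apply, smul_eq_mul]
      ring
    have hsn : ((blochCoord a ((2 * Real.pi) • ξ)).2.2 : ℝ) = 2 * Real.pi * ξ 1 := by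
      simp [blochCoord]
    have hn : ‖ξ‖ ^ 2 = ξ 0 ^ 2 + ξ 1 ^ 2 := by
      rw [EuclideanSpace.norm_sq_eq, Fin.sum_univ_two, Real.norm_eq_abs, Real.norm_eq_abs, sq_abs,
        sq_abs]
    have hw : (1 + (2 * Real.pi * ‖ξ‖) ^ 2) ^ (((2 : ℕ) : ℝ) / 2) =
        1 + (2 * Real.pi * ξ 0) ^ 2 + (2 * Real.pi * ξ 1) ^ 2 := by
      rw [mul_pow, hn]
      norm_num
      ring
    simp only [F, hfr, hsn, hw]
    rw [← ofReal_norm, ← ENNReal.ofReal_pow (norm_nonneg _), norm_mul, Complex.norm_real,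
      blochDensity, norm_mul, Complex.norm_real, Real.norm_of_nonneg (by positivity),
      Real.norm_of_nonneg (by positivity)]
  have hpi : (0 : ℝ) < (2 * Real.pi) ^ 2 := by positivity
  have e1 : ∀ σ, ∑' j : ℤ, F (j, σ) = ENNReal.ofReal (((2 * Real.pi) ^ 2) ^ 2) *
      K.indicator (fun σ => ENNReal.ofReal (Real.exp (2 * lam σ * t)) * ∑' j : ℤ, ENNReal.ofReal
        ((1 + (σ.1 + j) ^ 2 + σ.2 ^ 2) ^ 2 * ‖torusCoeff (W σ) j‖ ^ 2)) σ := by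
    intro σ
    by_cases hσ : σ ∈ K
    · simp only [hσ, Set.indicator_of_mem, ← ENNReal.tsum_mul_left, F, coeffOn, scaledCoeff]
      refine tsum_congr fun j => ?_
      rw [← ENNReal.ofReal_mul (Real.exp_pos _).le, ← ENNReal.ofReal_mul (by positivity), norm_mul,
        growth, Complex.norm_real, Real.norm_of_nonneg (Real.exp_pos _).le]
      have : Real.exp (2 * lam σ * t) = Real.exp (lam σ * t) ^ 2 := by
        rw [← Real.exp_nat_mul]; push_cast; ring_nf
      rw [this]
      congr 1
      ring
    · simp [F, coeffOn, hσ]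
  rw [e0, lintegral_blochCoord_smul a hF]
  simp only [e1]
  rw [lintegral_const_mul' _ _ ENNReal.ofReal_ne_top, ← mul_assoc,
    ← ENNReal.ofReal_mul (by positivity), lintegral_indicator hK.measurableSet,
    Measure.restrict_restrict hK.measurableSet, Set.inter_eq_left.2 hKa]
  congr 2
  field_simp

/-- Time enters only through `e^{2λ(σ)t}`; the remaining factor is controlled by the bounds on `W`
and the weight comparison, so the constants do not depend on `t`. -/
theorem exists_sobolevNorm_bounds (hK : IsCompact K) (hKa : K ⊆ strip a)
    (hl : ContinuousOn lam K) (hc : ∀ j, ContinuousOn (fun σ => torusCoeff (W σ) j) K)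
    (hAB : ∃ A B : ℝ, 0 < A ∧ 0 < B ∧ ∀ σ ∈ K, ENNReal.ofReal A ≤ torusSobolevSq 2 (W σ) ∧
      torusSobolevSq 2 (W σ) ≤ ENNReal.ofReal B)
    (hG : ∀ t, MemLp (blochDensity a K (scaledCoeff W (growth lam t))) 2 volume) :
    ∃ m₁ m₂ : ℝ, 0 < m₁ ∧ 0 < m₂ ∧ ∀ t,
      m₁ * ∫ σ in K, Real.exp (2 * lam σ * t) ≤ sobolevNorm 2 (𝓕⁻ (hG t).toLp) ^ 2 ∧
      sobolevNorm 2 (𝓕⁻ (hG t).toLp) ^ 2 ≤ m₂ * ∫ σ in K, Real.exp (2 * lam σ * t) := by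
  obtain ⟨A, B, hA, hB, hAB⟩ := hAB
  obtain ⟨c, hc0, hcw⟩ := exists_weight_comparison hK
  have hpi : (0 : ℝ) < (2 * Real.pi) ^ 2 := by positivity
  refine ⟨(2 * Real.pi) ^ 2 * ((c ^ 2)⁻¹ * A), (2 * Real.pi) ^ 2 * (c ^ 2 * B), by positivity,
    by positivity, fun t => ?_⟩
  have hint : IntegrableOn (fun σ => Real.exp (2 * lam σ * t)) K :=
    ContinuousOn.integrableOn_compact hK (by fun_prop)
  have hE0 : 0 ≤ ∫ σ in K, Real.exp (2 * lam σ * t) := integral_nonneg fun _ => (Real.exp_pos _).le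
  have hE : ∫⁻ σ in K, ENNReal.ofReal (Real.exp (2 * lam σ * t)) =
      ENNReal.ofReal (∫ σ in K, Real.exp (2 * lam σ * t)) :=
    (ofReal_integral_eq_lintegral_ofReal hint (Eventually.of_forall fun _ => (Real.exp_pos _).le)).symm
  have hN := sobolevNorm_two_sq hK hKa hl hc (hG t)
  set S : ℝ × ℝ → ℝ≥0∞ := fun σ => ∑' j : ℤ, ENNReal.ofReal
    ((1 + (σ.1 + j) ^ 2 + σ.2 ^ 2) ^ 2 * ‖torusCoeff (W σ) j‖ ^ 2) with hS
  have hup : ∀ σ ∈ K, S σ ≤ ENNReal.ofReal (c ^ 2 * B) := by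
    intro σ hσ
    calc S σ ≤ ∑' j : ℤ, ENNReal.ofReal (c ^ 2) *
          ENNReal.ofReal ((1 + (j : ℝ) ^ 2) ^ 2 * ‖torusCoeff (W σ) j‖ ^ 2) := by
          refine ENNReal.tsum_le_tsum fun j => ?_
          rw [← ENNReal.ofReal_mul (by positivity), ← mul_assoc, ← mul_pow c]
          have := (hcw σ hσ j).2
          gcongr
      _ = ENNReal.ofReal (c ^ 2) * torusSobolevSq 2 (W σ) := by
          rw [ENNReal.tsum_mul_left, torusSobolevSq]
      _ ≤ ENNReal.ofReal (c ^ 2) * ENNReal.ofReal B := by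
          gcongr
          exact (hAB σ hσ).2
      _ = _ := (ENNReal.ofReal_mul (by positivity)).symm
  have hlow : ∀ σ ∈ K, ENNReal.ofReal ((c ^ 2)⁻¹ * A) ≤ S σ := by
    intro σ hσ
    calc ENNReal.ofReal ((c ^ 2)⁻¹ * A) = ENNReal.ofReal (c ^ 2)⁻¹ * ENNReal.ofReal A :=
          ENNReal.ofReal_mul (by positivity)
      _ ≤ ENNReal.ofReal (c ^ 2)⁻¹ * torusSobolevSq 2 (W σ) := by
          gcongr
          exact (hAB σ hσ).1
      _ = ∑' j : ℤ, ENNReal.ofReal (c ^ 2)⁻¹ *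
          ENNReal.ofReal ((1 + (j : ℝ) ^ 2) ^ 2 * ‖torusCoeff (W σ) j‖ ^ 2) := by
          rw [ENNReal.tsum_mul_left, torusSobolevSq]
      _ ≤ S σ := by
          refine ENNReal.tsum_le_tsum fun j => ?_
          rw [← ENNReal.ofReal_mul (by positivity), ← mul_assoc]
          refine ENNReal.ofReal_le_ofReal (mul_le_mul_of_nonneg_right ?_ (by positivity))
          rw [inv_mul_le_iff₀ (by positivity), ← mul_pow]
          have := (hcw σ hσ j).1
          gcongr
  have hmul : ∀ m : ℝ, 0 ≤ m → ENNReal.ofReal ((2 * Real.pi) ^ 2) *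
      ∫⁻ σ in K, ENNReal.ofReal (Real.exp (2 * lam σ * t)) * ENNReal.ofReal m =
      ENNReal.ofReal ((2 * Real.pi) ^ 2 * m * ∫ σ in K, Real.exp (2 * lam σ * t)) := by
    intro m hm
    rw [lintegral_mul_const' _ _ ENNReal.ofReal_ne_top, hE, ← ENNReal.ofReal_mul hE0,
      ← ENNReal.ofReal_mul hpi.le]
    congr 1
    ring
  have h1 : ENNReal.ofReal ((2 * Real.pi) ^ 2 * ((c ^ 2)⁻¹ * A) *
      ∫ σ in K, Real.exp (2 * lam σ * t)) ≤ ENNReal.ofReal ((2 * Real.pi) ^ 2) *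
        ∫⁻ σ in K, ENNReal.ofReal (Real.exp (2 * lam σ * t)) * S σ := by
    rw [← hmul _ (by positivity)]
    exact mul_le_mul_right (setLIntegral_mono' hK.measurableSet fun σ hσ =>
      mul_le_mul_right (hlow σ hσ) _) _
  have h2 : ENNReal.ofReal ((2 * Real.pi) ^ 2) *
      ∫⁻ σ in K, ENNReal.ofReal (Real.exp (2 * lam σ * t)) * S σ ≤ ENNReal.ofReal ((2 * Real.pi) ^ 2 * (c ^ 2 * B) *
      ∫ σ in K, Real.exp (2 * lam σ * t)) := by
    rw [← hmul _ (by positivity)]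
    exact mul_le_mul_right (setLIntegral_mono' hK.measurableSet fun σ hσ =>
      mul_le_mul_right (hup σ hσ) _) _
  -- The lower bound needs finiteness: `toReal` sends `∞` to `0`.
  have hfin := ne_top_of_le_ne_top ENNReal.ofReal_ne_top h2
  rw [sobolevNorm, ← ENNReal.toReal_pow, hN]
  constructor
  · exact (ENNReal.ofReal_le_iff_le_toReal hfin).1 h1
  · exact ENNReal.toReal_le_of_le_ofReal (by positivity) h2

end

/-! ### Growth of superpositions of unstable modes -/

theorem exists_bound_potential {u : ℝ → ℝ} (hu : Continuous u)
    (hup : Function.Periodic u (2 * Real.pi)) (ε b s : ℝ) :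
    ∃ M, ∀ x, |potential ε b s u x| ≤ M := by
  have hq := continuous_potential hu ε b s
  have hp : Function.Periodic (fun x => (potential ε b s u x : ℂ)) (2 * Real.pi) := by
    intro x
    simp only [potential, hup x]
  obtain ⟨M, -, hM⟩ := exists_bound_of_periodic (Complex.continuous_ofReal.comp hq) hp
  refine ⟨M, fun x => ?_⟩
  have := hM x
  rwa [Function.comp_apply, Complex.norm_real] at this

theorem exp_mul_prefactor_sq (lam : ℝ × ℝ → ℝ) (σbar : ℝ × ℝ) (c t : ℝ) :
    (Real.exp (lam σbar * t) * prefactor lam σbar c t) ^ 2 =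
      ∫ σ in square σbar c, Real.exp (2 * lam σ * t) := by
  rw [mul_pow, prefactor, Real.sq_sqrt (integral_nonneg fun _ => (Real.exp_pos _).le),
    ← integral_const_mul]
  refine integral_congr_ae (Eventually.of_forall fun σ => ?_)
  simp only
  rw [← Real.exp_nat_mul, ← Real.exp_add]
  congr 1
  push_cast
  ring

theorem exists_two_sided_of_sq {ι : Type*} {S : Set ι} {X Y : ι → ℝ} {m₁ m₂ : ℝ} (h₁ : 0 < m₁)
    (hX : ∀ t ∈ S, 0 ≤ X t) (hY : ∀ t ∈ S, 0 ≤ Y t)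
    (h : ∀ t ∈ S, m₁ * X t ^ 2 ≤ Y t ^ 2 ∧ Y t ^ 2 ≤ m₂ * X t ^ 2) :
    ∃ C : ℝ, 1 ≤ C ∧ ∀ t ∈ S, C⁻¹ * X t ≤ Y t ∧ Y t ≤ C * X t := by
  -- Including `1` gives `C ≤ C²`, so `C²` dominates both `m₁⁻¹` and `m₂` and no square roots of
  -- constants are needed.
  refine ⟨max 1 (max m₁⁻¹ m₂), le_max_left _ _, fun t ht => ?_⟩
  set C := max 1 (max m₁⁻¹ m₂)
  have hC1 : 1 ≤ C := le_max_left _ _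
  have hC2 : m₁⁻¹ ≤ C := (le_max_left _ _).trans (le_max_right _ _)
  have hC3 : m₂ ≤ C := (le_max_right _ _).trans (le_max_right _ _)
  have hC0 : 0 < C := by linarith
  have hCC : C ≤ C ^ 2 := by nlinarith
  obtain ⟨ha, hb⟩ := h t ht
  have hXt := hX t ht
  have hYt := hY t ht
  constructor
  · rw [inv_mul_le_iff₀ hC0]
    refine (sq_le_sq₀ hXt (by positivity)).1 ?_
    have h3 : X t ^ 2 ≤ m₁⁻¹ * Y t ^ 2 := by
      rw [← div_eq_inv_mul, le_div_iff₀ h₁]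
      linarith
    calc X t ^ 2 ≤ m₁⁻¹ * Y t ^ 2 := h3
      _ ≤ C ^ 2 * Y t ^ 2 := by gcongr; exact hC2.trans hCC
      _ = (C * Y t) ^ 2 := by ring
  · refine (sq_le_sq₀ hYt (by positivity)).1 ?_
    calc Y t ^ 2 ≤ m₂ * X t ^ 2 := hb
      _ ≤ C ^ 2 * X t ^ 2 := by gcongr; exact hC3.trans hCC
      _ = (C * X t) ^ 2 := by ring

end RollInstability

end

open RollInstability in
theorem proposition2p3
    (ε ω b s : ℝ) (hb : b ≠ 0) (hs : 0 < 27 * s - 38 * b ^ 2)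
    (hε : 0 < ε) (hω : ω ∈ Set.Ioo (-1 / 2 : ℝ) (1 / 2)) (hk : 0 < 1 + 2 * ε * ω)
    (u : ℝ → ℝ) (hu : IsRoll ε ω b s u)
    (σbar : ℝ × ℝ) (c₀ : ℝ) (hc₀ : 0 < c₀) (hc₁ : c₀ ≤ 1)
    (lam : ℝ × ℝ → ℝ) (W : ℝ × ℝ → ℝ → ℂ)
    (hmax : ∀ (σ : ℝ × ℝ) (μ : ℝ), (∃ w, IsBlochEigenfunction ε ω b s u σ μ w) → μ ≤ lam σbar)
    (hpos : ∀ σ ∈ square σbar c₀, 0 < lam σ)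
    (hW : ∀ σ ∈ square σbar c₀, IsBlochEigenfunction ε ω b s u σ (lam σ) (W σ))
    (hcont : ContinuousFamilyOn 2 W (square σbar c₀)) :
    (∃ hU : MemLp (blochSuperposition (square σbar c₀) W) 2 (volume : Measure Plane),
      ∃ V : ℝ → L2Plane,
        IsSemigroupOrbit (LinearizedOp ε ω b s u) hU.toLp V ∧
        (∀ V' : ℝ → L2Plane, IsSemigroupOrbit (LinearizedOp ε ω b s u) hU.toLp V' →
          ∀ t, 0 ≤ t → V' t = V t) ∧
        (∀ t, 0 ≤ t → MemSobolev 2 2 (V t : 𝓢'(Plane, ℂ))) ∧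
        ∃ C : ℝ, 1 ≤ C ∧ ∀ t, 0 ≤ t →
          C⁻¹ * (Real.exp (lam σbar * t) * prefactor lam σbar c₀ t) ≤ sobolevNorm 2 (V t) ∧
          sobolevNorm 2 (V t) ≤ C * (Real.exp (lam σbar * t) * prefactor lam σbar c₀ t)) ∧
    (∃ l C₁ C₂ : ℝ, 0 < l ∧ 0 < C₁ ∧ 0 < C₂ ∧ ∀ t, 0 ≤ t →
      C₁ / (1 + t) ^ (1 / l) ≤ prefactor lam σbar c₀ t ∧ prefactor lam σbar c₀ t ≤ C₂) ∧
    (∀ l : ℕ, 0 < l →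
      (fun σ => lam σ - lam σbar) =O[𝓝[square σbar c₀] σbar] (fun σ => ‖σ - σbar‖ ^ l) →
      ∃ C₁ : ℝ, 0 < C₁ ∧ ∀ t, 0 ≤ t →
        C₁ / (1 + t) ^ (1 / (l : ℝ)) ≤ prefactor lam σbar c₀ t) := by
  set K := square σbar c₀ with hKdef
  have hK : IsCompact K := isCompact_square σbar c₀
  -- Here `c₀ ≤ 1` enters: the square fits into one period of the Bloch variable `σ₁`.
  have hKa : K ⊆ strip σbar.1 := fun σ hσ =>
    ⟨⟨hσ.1.1, hσ.1.2.trans (by linarith)⟩, Set.mem_univ _⟩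
  have hbar : σbar ∈ K := mem_square_self σbar hc₀.le
  have huc : Continuous u := hu.1.continuous
  have hup := hu.2.1
  obtain ⟨M, hM⟩ := exists_bound_potential huc hup ε b s
  have hWd : ∀ σ ∈ K, ContDiff ℝ 4 (W σ) := fun σ hσ => (hW σ hσ).1
  have hWp : ∀ σ ∈ K, Function.Periodic (W σ) (2 * Real.pi) := fun σ hσ => (hW σ hσ).2.1
  obtain ⟨hAB, ⟨D, hD0, hD⟩, hcc⟩ := exists_bounds_of_continuousFamilyOn hK hWd hWp
    (fun σ hσ => (hW σ hσ).2.2.1) hcont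
  obtain ⟨hsum, hjc, E, hE0, hE⟩ := continuousOn_uncurry_of_torusCoeff hWd hWp hD hcc
  have hlip : ∀ σ₀ ∈ K, (fun σ => lam σ - lam σ₀) =O[𝓝[K] σ₀] (fun σ => σ - σ₀) :=
    fun σ₀ h₀ => eigenvalue_sub_isBigO huc hW hjc hE h₀
  have hl : ContinuousOn lam K := by
    intro σ₀ h₀
    have h1 : Tendsto (fun σ : ℝ × ℝ => σ - σ₀) (𝓝[K] σ₀) (𝓝 0) := by
      have : Continuous (fun σ : ℝ × ℝ => σ - σ₀) := by fun_prop
      simpa using (this.tendsto σ₀).mono_left nhdsWithin_le_nhds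
    exact tendsto_sub_nhds_zero_iff.1 ((hlip σ₀ h₀).trans_tendsto h1)
  have hle : ∀ σ ∈ K, lam σ ≤ lam σbar := fun σ hσ => hmax σ _ ⟨_, hW σ hσ⟩
  refine ⟨?_, ?_, fun l hl0 hO => exists_prefactor_ge hc₀ hl hl0 hO⟩
  · have hA := continuousOn_growth (K := K) hl
    have hlA : ∀ t, ContinuousOn (fun σ => (lam σ : ℂ) * growth lam t σ) K := fun t =>
      (Complex.continuous_ofReal.comp_continuousOn hl).mul (hA t)
    have hG : ∀ t, MemLp (blochDensity σbar.1 K (scaledCoeff W (growth lam t))) 2 volume :=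
      fun t => memLp_scaledDensity hK (hA t) hcc hD
    have hG' : ∀ t, MemLp (blochDensity σbar.1 K
        (scaledCoeff W (fun σ => lam σ * growth lam t σ))) 2 volume :=
      fun t => memLp_scaledDensity hK (hlA t) hcc hD
    -- The orbit, defined for all real `t` because `λ` is bounded on `K`; two-sided derivatives are
    -- therefore available at every time.
    let V : ℝ → L2Plane := fun t => 𝓕⁻ ((hG t).toLp : L2Plane)
    have hV : ∀ t, ∀ᵐ p : Plane, V t p = ∫ σ in K, growth lam t σ * blochWave σ (W σ) p :=
      fun t => fourierInv_scaledDensity_ae_eq hK hKa (hA t) hcc hD hsum (hG t)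
    have hV' : ∀ t, ∀ᵐ p : Plane, (𝓕⁻ ((hG' t).toLp : L2Plane) : L2Plane) p =
        ∫ σ in K, (lam σ * growth lam t σ) * blochWave σ (W σ) p :=
      fun t => fourierInv_scaledDensity_ae_eq hK hKa (hlA t) hcc hD hsum (hG' t)
    have hop : ∀ t, LinearizedOp ε ω b s u (V t) (𝓕⁻ ((hG' t).toLp : L2Plane)) := fun t =>
      linearizedOp_superposition hk huc hup hM hW hK (hA t) hl hjc hE (hV t) (hV' t)
    have hV0 : ∀ᵐ p : Plane, V 0 p = blochSuperposition K W p := by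
      filter_upwards [hV 0] with p hp
      rw [hp]
      simp only [growth, blochSuperposition, blochWave, mul_zero, Real.exp_zero,
        Complex.ofReal_one, one_mul]
    have hderiv : ∀ t, HasDerivAt V (𝓕⁻ ((hG' t).toLp : L2Plane)) t := fun t =>
      (((Lp.fourierTransformₗᵢ Plane ℂ).symm.toContinuousLinearEquiv.toContinuousLinearMap
        ).restrictScalars ℝ).hasFDerivAt.comp_hasDerivAt t
        (hasDerivAt_toLp_scaledDensity hK hl hG hG' t)
    -- `U` inherits square integrability from `V 0`, with which it agrees almost everywhere.
    have hU : MemLp (blochSuperposition K W) 2 (volume : Measure Plane) :=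
      (memLp_congr_ae hV0).1 (Lp.memLp (V 0))
    have horbit : IsSemigroupOrbit (LinearizedOp ε ω b s u) hU.toLp V := by
      refine ⟨?_, fun t _ => (hderiv t).continuousAt.continuousWithinAt,
        fun t _ => ⟨_, hop t, hderiv t⟩⟩
      refine Lp.ext ?_
      filter_upwards [hV0, hU.coeFn_toLp] with p h1 h2
      rw [h1, h2]
    refine ⟨hU, V, horbit, fun V' h' t ht => horbit.eq_of_linearizedOp hM h' ht,
      fun t _ => (hop t).1.mono (by norm_num), ?_⟩
    obtain ⟨m₁, m₂, hm₁, -, hm⟩ := exists_sobolevNorm_bounds hK hKa hl hcc hAB hG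
    refine exists_two_sided_of_sq (S := Set.Ici (0 : ℝ))
      (X := fun t => Real.exp (lam σbar * t) * prefactor lam σbar c₀ t)
      (Y := fun t => sobolevNorm 2 (V t)) (m₂ := m₂) hm₁
      (fun t _ => mul_nonneg (Real.exp_pos _).le (Real.sqrt_nonneg _))
      (fun t _ => ENNReal.toReal_nonneg) (fun t _ => ?_)
    simp only [exp_mul_prefactor_sq]
    exact hm t
  -- The Lipschitz bound on the eigenvalue supplies the exponent `l = 1` without any further
  -- assumption on `λ`.
  · have hO : (fun σ => lam σ - lam σbar) =O[𝓝[K] σbar] (fun σ => ‖σ - σbar‖ ^ 1) := by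
      simpa using (hlip σbar hbar).norm_right
    obtain ⟨C₁, hC₁, h⟩ := exists_prefactor_ge hc₀ hl one_pos hO
    refine ⟨1, C₁, c₀, one_pos, hC₁, hc₀, fun t ht => ⟨?_, prefactor_le hc₀.le hl hle ht⟩⟩
    simpa using h t ht
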